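/- **Theorem (quasi-invariant limit of the Boltzmann binary-control model).** Let $H,G^1,\dots,G^d:\mathbb R^d\to\mathbb R^d$ be continuous (hence in $L^2_{loc}$) with at most linear growth, $|H(z)|\le C_H(1+|z|)$, $|G^\ell(z)|\le C_G^\ell(1+|z|)$. Let $\Theta_X,\Theta_Y$ be independent Bernoulli random variables with parameter $p\in[0,1]$, and let $\langle\cdot\rangle$ denote expectation with respect to them. Let $\mathcal U\subset\mathbb R^d$ be compact and, for $\alpha>0$, let $\mathbf U^1_\alpha,\mathbf U^2_\alpha:\mathbb R^d\times\mathbb R^d\to\mathcal U$ be measurable feedback controls. Assume that $\mathbf U^1_\alpha(X,Y)\to K^1(X,Y)$ and $\mathbf U^2_\alpha(Y,X)\to K^2(X,Y)$ as $\alpha\to0^+$, locally uniformly in $(X,Y)$, with $K^1,K^2$ continuous. The binary interaction of strength $\alpha$ is $$X^*=X+\alpha\Big(H(X-Y)(1-\Theta_X)(1-\Theta_Y)+\Theta_Y(1-\Theta_X)\sum_{\ell=1}^d G^\ell(X-Y)\,U^{2}_{\alpha,\ell}(Y,X)+\Theta_X\mathbf U^1_\alpha(X,Y)\Big),$$ $$Y^*=Y+\alpha\Big(H(Y-X)(1-\Theta_X)(1-\Theta_Y)+\Theta_X(1-\Theta_Y)\sum_{\ell=1}^d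 G^\ell(Y-X)\,U^{1}_{\alpha,\ell}(X,Y)+\Theta_Y\mathbf U^2_\alpha(Y,X)\Big).$$ Let $\mathcal P_1(\mathbb R^d)$ be the set of Borel probability measures on $\mathbb R^d$ with finite first moment, let $T>0$ and $\mu_0\in\mathcal P_1(\mathbb R^d)$. We write $\mu\in L^2([0,T],\mathcal P_1)$ if $\mu_t\in\mathcal P_1(\mathbb R^d)$ for all $t\in[0,T]$ and $t\mapsto\int|x|\,d\mu_t$ is in $L^2(0,T)$. A weak solution on $[0,T]$ of the Boltzmann equation with strength $\alpha$, frequency $\eta$ and initial datum $\mu_0$ is a map $\mu\in L^2([0,T],\mathcal P_1)$ (a probability measure $\mu_t$ for every $t$) with $\mu_{t=0}=\mu_0$ such that, for all $\varphi\in C_c^\infty(\mathbb R^d)$ and all $t\in[0,T]$ (one-sided derivatives at the end points), $$\frac{d}{dt}\int\varphi\,d\mu_t=\eta\,\Big\langle\iint\big(\varphi(X^*)-\varphi(X)\big)\,d\mu_t(Y)\,d\mu_t(X)\Big\rangle .$$ For every $\epsilon>0$ let $\mu^\epsilon$ be a weak solution with initial datum $\mu_0$ under the scaling $\alpha=\epsilon$,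 $\eta=1/\epsilon$. Then every sequence $\epsilon_n\to0^+$ has a subsequence $(\epsilon_{k_n})$, and there is $\mu\in L^2([0,T],\mathcal P_1)$ with $\mu_{t=0}=\mu_0$, such that for every $t\in[0,T]$, $\mu^{\epsilon_{k_n}}_t\to\mu_t$ narrowly and $\int|x|\,d\mu^{\epsilon_{k_n}}_t\to\int|x|\,d\mu_t$ (pointwise in time convergence in $\mathcal P_1$), and $\mu$ is a weak solution of $$\partial_t\mu+\mathrm{div}\Big[\Big(\int_{\mathbb R^d}\big\langle K(X,Y,K^1(X,Y),K^2(X,Y))\big\rangle\,d\mu_t(Y)\Big)\mu\Big]=0,$$ $$K(X,Y,u,v)=H(X-Y)(1-\Theta_X)(1-\Theta_Y)+\sum_{\ell=1}^dG^\ell(X-Y)\,v_\ell\,(1-\Theta_X)\Theta_Y+u\,\Theta_X,$$ that is, for all $\varphi\in C_c^\infty(\mathbb R^d)$ and $t\in[0,T]$, $\frac{d}{dt}\int\varphi\,d\mu_t=\int\nabla\varphi(X)\cdot\big(\int\langle K(X,Y,K^1(X,Y),K^2(X,Y))\rangle\,d\mu_t(Y)\big)d\mu_t(X)$. This limit is suboptimal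 for the mean-field control problem, in the following sense. Let $\bar X\in\mathbb R^d$, $\gamma>0$. Consider measurable controls $u(t,X,Y),v(t,X,Y)\in\mathcal U$ (of an agent at $X$ and of its partner at $Y$) together with $\mu\in L^2([0,T],\mathcal P_1)$ satisfying, in the weak sense integrated in time, $\partial_t\mu+\mathrm{div}[(\int\langle K(X,Y,u,v)\rangle d\mu_t(Y))\mu]=0$ and $\mu_{t=0}=\mu_0$; the cost is $$J=\int_0^T\Big(\int|\bar X-X|^2\,d\mu_t(X)+\gamma\iint|u(t,X,Y)|^2\,d\mu_t(Y)\,d\mu_t(X)\Big)dt\in[0,\infty].$$ Then the limit $\mu$ with $u=K^1$, $v=K^2$ is admissible, so that its cost is at least the infimum of $J$ over all such admissible pairs. If moreover $K^1(X,Y)=\kappa(X)$ and $K^2(X,Y)=\kappa(Y)$ for some $\kappa$, then the cost of $\mu$ with the control $\kappa$ is at least the infimum of $J$ over the admissible controls of the form $u=w(t,X)$, $v=w(t,Y)$. -/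

import Mathlib

open MeasureTheory ProbabilityTheory Filter Topology Set
open scoped ENNReal

namespace KineticControl

noncomputable section

/-- The state space `ℝ^d` with the Euclidean norm. -/
abbrev State (d : ℕ) : Type := EuclideanSpace ℝ (Fin d)

/-- At most linear growth: `|F z| ≤ C (1 + |z|)` for some constant `C`. -/
def LinearGrowth {d : ℕ} (F : State d → State d) : Prop :=
  ∃ C : ℝ, ∀ z, ‖F z‖ ≤ C * (1 + ‖z‖)

/-- A Bernoulli random variable: `Θ = 1` with probability `p`, `Θ = 0` with probability `1 - p`. -/
def IsBernoulli {Ω : Type*} [MeasurableSpace Ω] (P : Measure Ω) (Θ : Ω → ℝ) (p : ℝ) : Prop :=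
  Measurable Θ ∧ P {ω | Θ ω = 1} = ENNReal.ofReal p ∧ P {ω | Θ ω = 0} = ENNReal.ofReal (1 - p)

/-- The binary interaction, affine in the controls: the velocity of an agent (label `θ`, control
`u`) at displacement `z` from its partner (label `θ'`, control `v`),
`H(z)(1-θ)(1-θ') + ∑_ℓ G^ℓ(z) v_ℓ (1-θ) θ' + u θ`. -/
def interaction {d : ℕ} (H : State d → State d) (G : Fin d → State d → State d)
    (θ θ' : ℝ) (z u v : State d) : State d :=
  ((1 - θ) * (1 - θ')) • H z + ((1 - θ) * θ') • (∑ l, v l • G l z) + θ • u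

/-- The post-interaction states `(X*, Y*)` of two agents at `X` and `Y`, with interaction strength
`α`. The feedback of the first agent is `U₁ X Y`, that of the second agent is `U₂ Y X`. -/
def postInteraction {d : ℕ} (H : State d → State d) (G : Fin d → State d → State d) (α : ℝ)
    (U₁ U₂ : State d → State d → State d) (θX θY : ℝ) (X Y : State d) : State d × State d :=
  (X + α • interaction H G θX θY (X - Y) (U₁ X Y) (U₂ Y X),
   Y + α • interaction H G θY θX (Y - X) (U₂ Y X) (U₁ X Y))

/-- The averaged kernel `⟨K(X, Y, u, v)⟩`: the expectation over the labels `Θ_X`, `Θ_Y` of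
`H(X-Y)(1-Θ_X)(1-Θ_Y) + ∑_ℓ G^ℓ(X-Y) v_ℓ (1-Θ_X) Θ_Y + u Θ_X`. -/
def meanKernel {d : ℕ} {Ω : Type*} [MeasurableSpace Ω] (P : Measure Ω) (ΘX ΘY : Ω → ℝ)
    (H : State d → State d) (G : Fin d → State d → State d) (X Y u v : State d) : State d :=
  ∫ ω, interaction H G (ΘX ω) (ΘY ω) (X - Y) u v ∂P

/-- The space `𝒫₁(ℝ^d)` of probability measures with finite first moment. -/
def HasFirstMoment {d : ℕ} (μ : ProbabilityMeasure (State d)) : Prop :=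
  Integrable (fun x : State d => ‖x‖) (μ : Measure (State d))

/-- The class `L²([0,T], 𝒫₁(ℝ^d))`: every `μ t` has a finite first moment (its Wasserstein
distance to the Dirac mass at `0`), and the first moment is square integrable in time. -/
def MemL2P1 {d : ℕ} (T : ℝ) (μ : ℝ → ProbabilityMeasure (State d)) : Prop :=
  (∀ t ∈ Icc 0 T, HasFirstMoment (μ t)) ∧
    MemLp (fun t => ∫ x, ‖x‖ ∂(μ t : Measure (State d))) 2 (volume.restrict (Icc 0 T))

/-- The Boltzmann collision operator of strength `α` and frequency `η`, tested against `φ`: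
`η ⟨∫∫ (φ(X*) - φ(X)) dμ(Y) dμ(X)⟩`, where `⟨·⟩` is the expectation over the labels. -/
def boltzmannOperator {d : ℕ} {Ω : Type*} [MeasurableSpace Ω] (P : Measure Ω) (ΘX ΘY : Ω → ℝ)
    (H : State d → State d) (G : Fin d → State d → State d) (α η : ℝ)
    (U₁ U₂ : State d → State d → State d) (μ : Measure (State d)) (φ : State d → ℝ) : ℝ :=
  η * ∫ ω, ∫ X, ∫ Y,
    (φ (postInteraction H G α U₁ U₂ (ΘX ω) (ΘY ω) X Y).1 - φ X) ∂μ ∂μ ∂P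

/-- Weak solutions on `[0,T]` of the Boltzmann equation `∂ₜ μ = Q_α(μ, μ)` with initial datum
`μ₀` (one-sided time derivatives at the end points). -/
structure IsBoltzmannSolution {d : ℕ} {Ω : Type*} [MeasurableSpace Ω] (P : Measure Ω)
    (ΘX ΘY : Ω → ℝ) (H : State d → State d) (G : Fin d → State d → State d) (α η : ℝ)
    (U₁ U₂ : State d → State d → State d) (T : ℝ) (μ₀ : ProbabilityMeasure (State d))
    (μ : ℝ → ProbabilityMeasure (State d)) : Prop where
  memL2P1 : MemL2P1 T μ
  initial : μ 0 = μ₀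
  weak : ∀ φ : State d → ℝ, ContDiff ℝ (⊤ : ℕ∞) φ → HasCompactSupport φ → ∀ t ∈ Icc 0 T,
    HasDerivWithinAt (fun s => ∫ x, φ x ∂(μ s : Measure (State d)))
      (boltzmannOperator P ΘX ΘY H G α η U₁ U₂ (μ t : Measure (State d)) φ) (Icc 0 T) t

/-- The transport operator tested against `φ`: `∫ ∇φ(X) · (∫ V(X,Y) dμ(Y)) dμ(X)`. -/
def transportOperator {d : ℕ} (V : State d → State d → State d) (μ : Measure (State d))
    (φ : State d → ℝ) : ℝ :=
  ∫ X, fderiv ℝ φ X (∫ Y, V X Y ∂μ) ∂μ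

/-- Weak solutions on `[0,T]` of the nonlocal continuity equation
`∂ₜ μ + div ((∫ V(X,Y) dμ(Y)) μ) = 0` with initial datum `μ₀`. -/
structure IsContinuitySolution {d : ℕ} (V : State d → State d → State d) (T : ℝ)
    (μ₀ : ProbabilityMeasure (State d)) (μ : ℝ → ProbabilityMeasure (State d)) : Prop where
  memL2P1 : MemL2P1 T μ
  initial : μ 0 = μ₀
  weak : ∀ φ : State d → ℝ, ContDiff ℝ (⊤ : ℕ∞) φ → HasCompactSupport φ → ∀ t ∈ Icc 0 T,
    HasDerivWithinAt (fun s => ∫ x, φ x ∂(μ s : Measure (State d)))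
      (transportOperator V (μ t : Measure (State d)) φ) (Icc 0 T) t

/-- A time-dependent control of the mean-field equation: in the interaction of an agent at `X` with
a partner at `Y`, the agent uses `own t X Y` and the partner uses `partner t X Y`. -/
structure MeanFieldControl (d : ℕ) where
  own : ℝ → State d → State d → State d
  partner : ℝ → State d → State d → State d

/-- The control in which each agent uses the feedback `w t` of its own state. -/
def MeanFieldControl.ofFeedback {d : ℕ} (w : ℝ → State d → State d) : MeanFieldControl d where
  own t X _ := w t X
  partner t _ Y := w t Y

/-- The stationary control given by two functions of the pair of states. -/
def MeanFieldControl.stationary {d : ℕ} (K₁ K₂ : State d → State d → State d) :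
    MeanFieldControl d where
  own _ X Y := K₁ X Y
  partner _ X Y := K₂ X Y

/-- Admissible pairs of the mean-field optimal control problem: the control `c` is measurable with
values in `𝒰`, and `μ` solves the controlled mean-field equation
`∂ₜ μ + div ((∫ ⟨K(X, Y, c)⟩ dμ(Y)) μ) = 0`, `μ 0 = μ₀`. Since the control is only measurable in
time, the weak formulation is integrated in time. -/
structure IsAdmissible {d : ℕ} {Ω : Type*} [MeasurableSpace Ω] (P : Measure Ω)
    (ΘX ΘY : Ω → ℝ) (H : State d → State d) (G : Fin d → State d → State d)
    (𝒰 : Set (State d)) (T : ℝ) (μ₀ : ProbabilityMeasure (State d))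
    (μ : ℝ → ProbabilityMeasure (State d)) (c : MeanFieldControl d) : Prop where
  measurable_own : Measurable fun q : ℝ × State d × State d => c.own q.1 q.2.1 q.2.2
  measurable_partner : Measurable fun q : ℝ × State d × State d => c.partner q.1 q.2.1 q.2.2
  own_mem : ∀ t ∈ Icc 0 T, ∀ X Y, c.own t X Y ∈ 𝒰
  partner_mem : ∀ t ∈ Icc 0 T, ∀ X Y, c.partner t X Y ∈ 𝒰
  memL2P1 : MemL2P1 T μ
  initial : μ 0 = μ₀
  integrable : ∀ φ : State d → ℝ, ContDiff ℝ (⊤ : ℕ∞) φ → HasCompactSupport φ →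
    IntervalIntegrable (fun s => transportOperator
      (fun X Y => meanKernel P ΘX ΘY H G X Y (c.own s X Y) (c.partner s X Y))
      (μ s : Measure (State d)) φ) volume 0 T
  weak : ∀ φ : State d → ℝ, ContDiff ℝ (⊤ : ℕ∞) φ → HasCompactSupport φ → ∀ t ∈ Icc 0 T,
    ∫ x, φ x ∂(μ t : Measure (State d)) = ∫ x, φ x ∂(μ₀ : Measure (State d)) +
      ∫ s in (0 : ℝ)..t, transportOperator
        (fun X Y => meanKernel P ΘX ΘY H G X Y (c.own s X Y) (c.partner s X Y))
        (μ s : Measure (State d)) φ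

/-- The mean-field cost `∫₀ᵀ (∫ |X̄ - X|² dμ_t(X) + γ ∫∫ |u(t,X,Y)|² dμ_t(Y) dμ_t(X)) dt`, with
`u` the control of the agent itself. -/
def cost {d : ℕ} (T γ : ℝ) (Xbar : State d) (μ : ℝ → ProbabilityMeasure (State d))
    (c : MeanFieldControl d) : ℝ≥0∞ :=
  ∫⁻ t in Icc 0 T, ((∫⁻ X, ENNReal.ofReal (‖Xbar - X‖ ^ 2) ∂(μ t : Measure (State d))) +
    ENNReal.ofReal γ * ∫⁻ X, ∫⁻ Y, ENNReal.ofReal (‖c.own t X Y‖ ^ 2)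
      ∂(μ t : Measure (State d)) ∂(μ t : Measure (State d)))

/-- The optimal cost over all controls that may depend on the states of both agents. -/
def binaryValue {d : ℕ} {Ω : Type*} [MeasurableSpace Ω] (P : Measure Ω)
    (ΘX ΘY : Ω → ℝ) (H : State d → State d) (G : Fin d → State d → State d)
    (𝒰 : Set (State d)) (T γ : ℝ) (Xbar : State d) (μ₀ : ProbabilityMeasure (State d)) : ℝ≥0∞ :=
  ⨅ (μ : ℝ → ProbabilityMeasure (State d)) (c : MeanFieldControl d)
    (_ : IsAdmissible P ΘX ΘY H G 𝒰 T μ₀ μ c), cost T γ Xbar μ c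

/-- The optimal cost over the feedback controls `u(X, t)` of each agent's own state. -/
def feedbackValue {d : ℕ} {Ω : Type*} [MeasurableSpace Ω] (P : Measure Ω)
    (ΘX ΘY : Ω → ℝ) (H : State d → State d) (G : Fin d → State d → State d)
    (𝒰 : Set (State d)) (T γ : ℝ) (Xbar : State d) (μ₀ : ProbabilityMeasure (State d)) : ℝ≥0∞ :=
  ⨅ (μ : ℝ → ProbabilityMeasure (State d)) (w : ℝ → State d → State d)
    (_ : IsAdmissible P ΘX ΘY H G 𝒰 T μ₀ μ (MeanFieldControl.ofFeedback w)),
    cost T γ Xbar μ (MeanFieldControl.ofFeedback w)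

end

end KineticControl

open KineticControl

/-! The labels take almost surely four pairs of values, so `⟨·⟩` is a finite weighted sum. With `η =
1/α` the Boltzmann operator is the integral over `ν ⊗ ν` of `∑ w_i α⁻¹ (φ(X + α k_i) - φ(X))`
(`boltzmannOperator_eq`). The velocities `k_i` grow at most linearly, uniformly in `α`, because the
controls stay in a compact set. For `L`-Lipschitz `φ` the integrand is therefore at most `L C (1 +
|X| + |Y|)`: the factor `1/α` cancels the size `α` of the jump. Grönwall then bounds the first
moments uniformly in `α` and time, and `t ↦ ∫ φ dν_t` is equi-Lipschitz.

Bounded first moments do not suffice for the limit: the velocity of an agent in the support of `φ`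
still grows with the distance of its partner, so the moments have to be uniformly integrable. This
is propagated from `μ₀` (`exists_radius_integral_max_le`). If `φ` vanishes on a large enough ball,
collisions inside a smaller ball do not see it, and outside the smaller ball `1 + |X| + |Y|` is
bounded by the excess over a yet smaller radius `r`. The tail at the large radius is thus driven by
the time integral of the tail at `r`. Iterating `n` times leaves a remainder `M (KT)^n / n!`, so
finitely many enlargements of the radius give any prescribed accuracy.

All solutions thus stay in one narrowly compact set `tailSet R`, and an Arzelà–Ascoli argument gives
a subsequence converging at every time (`exists_subseq_tendsto`). On `tailSet R`, narrow convergence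
passes to integrals over `ν ⊗ ν` of functions of linear growth (`tendsto_integral_prod_of_tailSet`).
The difference quotients converge locally uniformly to `∇φ · k_i`, so the equation integrated in
time passes to the limit by dominated convergence. The limit flux is continuous in time, which
returns the derivative at every time. Finally `K¹`, `K²` take values in the closed set `𝒰`, so the
limit is an admissible competitor and its cost is at least the infimum. -/

namespace KineticControl

variable {d : ℕ}

/-! ### Compact sets of measures with uniformly integrable first moments -/

/-- The probability measures whose first moments are uniformly integrable, with tails controlled by
the radii `R j`. -/
def tailSet (R : ℕ → ℝ) : Set (ProbabilityMeasure (State d)) :=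
  {ν | ∀ j : ℕ, ∫⁻ x, ENNReal.ofReal (‖x‖ - R j) ∂(ν : Measure (State d)) ≤
    ENNReal.ofReal (1 / (j + 1))}

/-- Lower semicontinuity: the integral is the supremum over `N` of the integrals of the truncations
`min f N`, whose positive parts are bounded and continuous. -/
theorem isClosed_setOf_lintegral_ofReal_le {E : Type*} [TopologicalSpace E] [MeasurableSpace E]
    [OpensMeasurableSpace E] {f : E → ℝ} (hf : Continuous f) (c : ℝ≥0∞) :
    IsClosed {ν : ProbabilityMeasure E | ∫⁻ x, ENNReal.ofReal (f x) ∂(ν : Measure E) ≤ c} := by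
  have hg (N : ℕ) : Continuous fun ν : ProbabilityMeasure E =>
      ∫⁻ x, ENNReal.ofReal (min (f x) N) ∂(ν : Measure E) := by
    rw [continuous_iff_continuousAt]
    intro ν
    let g : BoundedContinuousFunction E NNReal :=
      BoundedContinuousFunction.mkOfBound ⟨fun x => (min (f x) N).toNNReal, by fun_prop⟩ N (by
        intro x y
        rw [NNReal.dist_eq]
        simp only [ContinuousMap.coe_mk, Real.coe_toNNReal']
        have hN : (0 : ℝ) ≤ N := N.cast_nonneg
        have h1 : max (min (f x) (N : ℝ)) 0 ≤ N := max_le (min_le_right _ _) hN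
        have h2 : max (min (f y) (N : ℝ)) 0 ≤ N := max_le (min_le_right _ _) hN
        have h3 : 0 ≤ max (min (f x) (N : ℝ)) 0 := le_max_right _ _
        have h4 : 0 ≤ max (min (f y) (N : ℝ)) 0 := le_max_right _ _
        rw [abs_le]; constructor <;> linarith)
    exact (ProbabilityMeasure.tendsto_iff_forall_lintegral_tendsto.1 tendsto_id) g
  have hsup (ν : ProbabilityMeasure E) : ∫⁻ x, ENNReal.ofReal (f x) ∂(ν : Measure E) =
      ⨆ N : ℕ, ∫⁻ x, ENNReal.ofReal (min (f x) N) ∂(ν : Measure E) := by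
    rw [← lintegral_iSup]
    · refine lintegral_congr fun x => le_antisymm ?_ ?_
      · obtain ⟨N, hN⟩ := exists_nat_ge (f x)
        refine le_iSup_of_le N ?_
        rw [min_eq_left hN]
      · exact iSup_le fun N => ENNReal.ofReal_le_ofReal (min_le_left _ _)
    · intro N; fun_prop
    · intro N M h x
      exact ENNReal.ofReal_le_ofReal (min_le_min le_rfl (by exact_mod_cast h))
  simp_rw [hsup, iSup_le_iff, Set.ofPred_forall]
  exact isClosed_iInter fun N => isClosed_le (hg N) continuous_const

theorem isClosed_tailSet (R : ℕ → ℝ) : IsClosed (tailSet (d := d) R) := by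
  simp only [tailSet, Set.ofPred_forall]
  exact isClosed_iInter fun j => isClosed_setOf_lintegral_ofReal_le (by fun_prop) _

/-- Prokhorov: outside the ball of radius `2 R j` one has `‖x‖ - R j > 1`, so the tail bound is also
a bound `1 / (j + 1)` on the mass there. -/
theorem isCompact_tailSet {R : ℕ → ℝ} (hR : ∀ j, 1 ≤ R j) : IsCompact (tailSet (d := d) R) := by
  have hu : Tendsto (fun j : ℕ => Real.toNNReal (1 / ((j : ℝ) + 1))) atTop (𝓝 0) := by
    have := (continuous_real_toNNReal.tendsto 0).comp
      (tendsto_one_div_add_atTop_nhds_zero_nat (𝕜 := ℝ))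
    simpa [Function.comp_def] using this
  refine (isCompact_setOfPred_probabilityMeasure_mass_eq_compl_isCompact_le hu
    (K := fun j => Metric.closedBall (0 : State d) (2 * R j))
    (fun j => isCompact_closedBall _ _) (.inl inferInstance)).of_isClosed_subset
    (isClosed_tailSet R) ?_
  intro ν hν j
  have h := hν j
  rw [← ENNReal.coe_le_coe, ProbabilityMeasure.ennreal_coeFn_eq_coeFn_toMeasure]
  refine le_trans ?_ h
  calc (ν : Measure (State d)) (Metric.closedBall (0 : State d) (2 * R j))ᶜ
      = ∫⁻ x, (Metric.closedBall (0 : State d) (2 * R j))ᶜ.indicator 1 x ∂(ν : Measure (State d)) := by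
        rw [lintegral_indicator_one Metric.isClosed_closedBall.measurableSet.compl]
    _ ≤ _ := by
        refine lintegral_mono fun x => ?_
        by_cases hx : x ∈ (Metric.closedBall (0 : State d) (2 * R j))ᶜ
        · rw [indicator_of_mem hx]
          simp only [Pi.one_apply]
          rw [← ENNReal.ofReal_one]
          apply ENNReal.ofReal_le_ofReal
          have : 2 * R j < ‖x‖ := by simpa using hx
          linarith [hR j]
        · rw [indicator_of_notMem hx]; exact zero_le

theorem hasFirstMoment_of_mem_tailSet {R : ℕ → ℝ} {ν : ProbabilityMeasure (State d)}
    (hν : ν ∈ tailSet R) : HasFirstMoment ν := by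
  have h := hν 0
  have h1 : Integrable (fun x : State d => max (‖x‖ - R 0) 0) (ν : Measure (State d)) := by
    refine ⟨by fun_prop, ?_⟩
    rw [hasFiniteIntegral_iff_ofReal (f := fun x : State d => max (‖x‖ - R 0) 0)
      (Eventually.of_forall fun x => le_max_right _ _)]
    refine lt_of_le_of_lt ?_ (h.trans_lt ENNReal.ofReal_lt_top)
    exact lintegral_mono fun x => by rw [ENNReal.ofReal_max]; simp
  refine (h1.add (integrable_const |R 0|)).mono' (by fun_prop) (Eventually.of_forall fun x => ?_)
  simp only [norm_norm, Pi.add_apply]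
  linarith [le_max_left (‖x‖ - R 0) 0, le_abs_self (R 0)]

theorem HasFirstMoment.integrable_max {ν : ProbabilityMeasure (State d)} (hν : HasFirstMoment ν)
    (r : ℝ) : Integrable (fun x : State d => max (‖x‖ - r) 0) (ν : Measure (State d)) :=
  (Integrable.sub hν (integrable_const r)).sup (integrable_const 0)

/-- The integrals in `ℝ≥0∞` of the definition make the set closed with no integrability condition;
real integrals are the form in which the estimates arrive. -/
theorem mem_tailSet_iff {R : ℕ → ℝ} {ν : ProbabilityMeasure (State d)} :
    ν ∈ tailSet R ↔ HasFirstMoment ν ∧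
      ∀ j : ℕ, ∫ x, max (‖x‖ - R j) 0 ∂(ν : Measure (State d)) ≤ 1 / (j + 1) := by
  have key (hm : HasFirstMoment ν) (r : ℝ) :
      ∫⁻ x, ENNReal.ofReal (‖x‖ - r) ∂(ν : Measure (State d)) =
        ENNReal.ofReal (∫ x, max (‖x‖ - r) 0 ∂(ν : Measure (State d))) := by
    rw [ofReal_integral_eq_lintegral_ofReal (hm.integrable_max r)
      (Eventually.of_forall fun x => le_max_right _ _)]
    exact lintegral_congr fun x => by rw [ENNReal.ofReal_max]; simp
  constructor
  · intro h
    have hm := hasFirstMoment_of_mem_tailSet h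
    refine ⟨hm, fun j => ?_⟩
    have := h j
    rw [key hm] at this
    exact (ENNReal.ofReal_le_ofReal_iff (by positivity)).1 this
  · rintro ⟨hm, h⟩ j
    rw [key hm]
    exact ENNReal.ofReal_le_ofReal (h j)

/-! ### Functions of linear growth on pairs of states -/

theorem HasFirstMoment.integrable_fst {ν : ProbabilityMeasure (State d)} (hν : HasFirstMoment ν) :
    Integrable (fun z : State d × State d => ‖z.1‖)
      ((ν : Measure (State d)).prod (ν : Measure (State d))) :=
  Integrable.comp_fst (f := fun x : State d => ‖x‖) hν _

theorem HasFirstMoment.integrable_snd {ν : ProbabilityMeasure (State d)} (hν : HasFirstMoment ν) :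
    Integrable (fun z : State d × State d => ‖z.2‖)
      ((ν : Measure (State d)).prod (ν : Measure (State d))) :=
  Integrable.comp_snd (f := fun x : State d => ‖x‖) hν _

/-- Functions of linear growth are integrable against `ν ⊗ ν`. -/
theorem HasFirstMoment.integrable_of_growth {F : Type*} [NormedAddCommGroup F]
    {ν : ProbabilityMeasure (State d)}
    (hν : HasFirstMoment ν) {b : State d × State d → F} {C : ℝ}
    (hbm : AEStronglyMeasurable b ((ν : Measure (State d)).prod (ν : Measure (State d))))
    (hb : ∀ z, ‖b z‖ ≤ C * (1 + ‖z.1‖ + ‖z.2‖)) :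
    Integrable b ((ν : Measure (State d)).prod (ν : Measure (State d))) :=
  ((((integrable_const 1).add hν.integrable_fst).add hν.integrable_snd).const_mul C).mono' hbm
    (Eventually.of_forall hb)

/-- The excess of a pair of states over the radius `r`. -/
noncomputable def excess (r : ℝ) (z : State d × State d) : ℝ :=
  max (‖z.1‖ - r) 0 + max (‖z.2‖ - r) 0

theorem excess_nonneg (r : ℝ) (z : State d × State d) : 0 ≤ excess r z :=
  add_nonneg (le_max_right _ _) (le_max_right _ _)

/-- If `m` is the larger norm, then `m > 2 r ≥ 2`, hence `1 + ‖z.1‖ + ‖z.2‖ ≤ 3 m ≤ 6 (m - r)`. -/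
theorem growth_le_excess {r : ℝ} (hr : 1 ≤ r) {z : State d × State d}
    (hz : 2 * r < ‖z.1‖ ∨ 2 * r < ‖z.2‖) : 1 + ‖z.1‖ + ‖z.2‖ ≤ 6 * excess r z := by
  have h1 := le_max_left (‖z.1‖ - r) 0
  have h2 := le_max_left (‖z.2‖ - r) 0
  have h3 := le_max_right (‖z.1‖ - r) 0
  have h4 := le_max_right (‖z.2‖ - r) 0
  unfold excess
  rcases le_total ‖z.1‖ ‖z.2‖ with h | h <;> rcases hz with hz | hz <;> linarith

theorem HasFirstMoment.integrable_excess {ν : ProbabilityMeasure (State d)}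
    (hν : HasFirstMoment ν) (r : ℝ) :
    Integrable (excess r) ((ν : Measure (State d)).prod (ν : Measure (State d))) :=
  (Integrable.comp_fst (hν.integrable_max r) _).add (Integrable.comp_snd (hν.integrable_max r) _)

theorem integral_comp_fst_self (ν : ProbabilityMeasure (State d)) (f : State d → ℝ) :
    ∫ z, f z.1 ∂((ν : Measure (State d)).prod (ν : Measure (State d))) =
      ∫ x, f x ∂(ν : Measure (State d)) := by
  rw [integral_fun_fst]; simp

theorem integral_comp_snd_self (ν : ProbabilityMeasure (State d)) (f : State d → ℝ) :
    ∫ z, f z.2 ∂((ν : Measure (State d)).prod (ν : Measure (State d))) =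
      ∫ x, f x ∂(ν : Measure (State d)) := by
  rw [integral_fun_snd]; simp

theorem HasFirstMoment.integral_excess {ν : ProbabilityMeasure (State d)}
    (hν : HasFirstMoment ν) (r : ℝ) :
    ∫ z, excess r z ∂((ν : Measure (State d)).prod (ν : Measure (State d))) =
      2 * ∫ x, max (‖x‖ - r) 0 ∂(ν : Measure (State d)) := by
  unfold excess
  rw [integral_add (Integrable.comp_fst (hν.integrable_max r) _)
    (Integrable.comp_snd (hν.integrable_max r) _),
    integral_comp_fst_self ν fun x => max (‖x‖ - r) 0,
    integral_comp_snd_self ν fun x => max (‖x‖ - r) 0, two_mul]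

/-- Integrals of locally uniformly converging functions of linear growth converge along a narrowly
converging family with uniformly integrable first moments. -/
theorem tendsto_integral_prod_of_tailSet {ι : Type*} {l : Filter ι} {R : ℕ → ℝ}
    (hR : ∀ j, 1 ≤ R j) {ν : ι → ProbabilityMeasure (State d)} {ν' : ProbabilityMeasure (State d)}
    (hν : ∀ᶠ i in l, ν i ∈ tailSet R) (hν' : ν' ∈ tailSet R) (hlim : Tendsto ν l (𝓝 ν'))
    {b : ι → State d × State d → ℝ} {b' : State d × State d → ℝ} {C : ℝ}
    (hbm : ∀ᶠ i in l, Measurable (b i))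
    (hb : ∀ᶠ i in l, ∀ z, ‖b i z‖ ≤ C * (1 + ‖z.1‖ + ‖z.2‖))
    (hb'c : Continuous b') (hb' : ∀ z, ‖b' z‖ ≤ C * (1 + ‖z.1‖ + ‖z.2‖))
    (hbb : TendstoLocallyUniformly b b' l) :
    Tendsto (fun i => ∫ z, b i z ∂((ν i : Measure (State d)).prod (ν i : Measure (State d)))) l
      (𝓝 (∫ z, b' z ∂((ν' : Measure (State d)).prod (ν' : Measure (State d))))) := by
  have hC : 0 ≤ C := by
    have := (norm_nonneg _).trans (hb' 0)
    simpa using this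
  rw [Metric.tendsto_nhds]
  intro η hη
  -- Error budget: truncation costs `24 C / (j + 1)` for each of `ν i` and `ν'`, together less than
  -- `η / 3`. The other two thirds pay for `b i - b'` on the ball of radius `2 r` and for the
  -- convergence of the truncated integrals.
  obtain ⟨j, hj⟩ : ∃ j : ℕ, (48 * C + 1) * (1 / ((j : ℝ) + 1)) < η / 3 := by
    have h := (tendsto_one_div_add_atTop_nhds_zero_nat (𝕜 := ℝ)).const_mul (48 * C + 1)
    rw [mul_zero] at h
    exact (h.eventually (gt_mem_nhds (by positivity : (0 : ℝ) < η / 3))).exists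
  set r := R j with hr
  set N := C * (1 + 4 * r) with hN
  have hr1 : 1 ≤ r := hR j
  have hN0 : 0 ≤ N := by positivity
  -- The truncation of `b'` at the level `N` that it cannot exceed when both states lie in the ball
  -- of radius `2 r`: bounded, continuous, and equal to `b'` there.
  let b₀ : State d × State d → ℝ := fun z => max (-N) (min (b' z) N)
  have hb₀c : Continuous b₀ := by fun_prop
  have hb₀N (z) : ‖b₀ z‖ ≤ N :=
    abs_le.2 ⟨le_max_left _ _, max_le (by linarith) (min_le_right _ _)⟩
  have hb₀g (z) : ‖b₀ z‖ ≤ ‖b' z‖ := by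
    simp only [b₀, Real.norm_eq_abs]
    rcases abs_cases (b' z) with h | h <;> rw [abs_le] <;> refine ⟨?_, ?_⟩ <;>
      first
      | (rw [max_le_iff]; constructor <;> [linarith; exact (min_le_left _ _).trans (by linarith)])
      | (rw [le_max_iff]; right; rw [le_min_iff]; constructor <;> linarith)
  have hb₀e (z : State d × State d) (h1 : ‖z.1‖ ≤ 2 * r) (h2 : ‖z.2‖ ≤ 2 * r) : b₀ z = b' z := by
    have h : ‖b' z‖ ≤ N := (hb' z).trans (by
      rw [hN]; exact mul_le_mul_of_nonneg_left (by linarith) hC)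
    rw [Real.norm_eq_abs, abs_le] at h
    simp only [b₀]
    rw [min_eq_left h.2, max_eq_right h.1]
  have hclose (f : State d × State d → ℝ) {δ : ℝ} (hδ : 0 ≤ δ)
      (hf : ∀ z, ‖f z‖ ≤ C * (1 + ‖z.1‖ + ‖z.2‖))
      (hfd : ∀ z : State d × State d, ‖z.1‖ ≤ 2 * r → ‖z.2‖ ≤ 2 * r → ‖f z - b' z‖ ≤ δ)
      (z) : ‖f z - b₀ z‖ ≤ δ + 12 * C * excess r z := by
    by_cases hz : ‖z.1‖ ≤ 2 * r ∧ ‖z.2‖ ≤ 2 * r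
    · rw [hb₀e z hz.1 hz.2]
      have := excess_nonneg r z
      exact (hfd z hz.1 hz.2).trans (le_add_of_nonneg_right (by positivity))
    · rw [not_and_or, not_le, not_le] at hz
      calc ‖f z - b₀ z‖ ≤ ‖f z‖ + ‖b₀ z‖ := norm_sub_le _ _
        _ ≤ C * (1 + ‖z.1‖ + ‖z.2‖) + C * (1 + ‖z.1‖ + ‖z.2‖) :=
            add_le_add (hf z) ((hb₀g z).trans (hb' z))
        _ = 2 * C * (1 + ‖z.1‖ + ‖z.2‖) := by ring
        _ ≤ 2 * C * (6 * excess r z) := by gcongr; exact growth_le_excess hr1 hz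
        _ ≤ _ := by linarith
  have hint (ρ : ProbabilityMeasure (State d)) (hρ : ρ ∈ tailSet R)
      (f : State d × State d → ℝ) {δ : ℝ} (hδ : 0 ≤ δ) (hfm : Measurable f)
      (hf : ∀ z, ‖f z‖ ≤ C * (1 + ‖z.1‖ + ‖z.2‖))
      (hfd : ∀ z : State d × State d, ‖z.1‖ ≤ 2 * r → ‖z.2‖ ≤ 2 * r → ‖f z - b' z‖ ≤ δ) :
      |∫ z, f z ∂((ρ : Measure (State d)).prod (ρ : Measure (State d))) -
        ∫ z, b₀ z ∂((ρ : Measure (State d)).prod (ρ : Measure (State d)))| ≤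
        δ + 24 * C * (1 / ((j : ℝ) + 1)) := by
    obtain ⟨hm, ht⟩ := mem_tailSet_iff.1 hρ
    rw [← integral_sub (hm.integrable_of_growth hfm.aestronglyMeasurable hf)
      (hm.integrable_of_growth hb₀c.aestronglyMeasurable fun z => (hb₀g z).trans (hb' z))]
    refine (norm_integral_le_of_norm_le
      ((integrable_const δ).add ((hm.integrable_excess r).const_mul (12 * C)))
      (Eventually.of_forall (hclose f hδ hf hfd))).trans ?_
    simp only [Pi.add_apply]
    rw [integral_add (integrable_const δ) ((hm.integrable_excess r).const_mul (12 * C)),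
      integral_const_mul, hm.integral_excess]
    simp only [integral_const, probReal_univ, smul_eq_mul, one_mul]
    have := mul_le_mul_of_nonneg_left (ht j) (by positivity : 0 ≤ 24 * C)
    linarith
  have hbdd : Tendsto (fun i => ∫ z, b₀ z ∂((ν i : Measure (State d)).prod (ν i : Measure (State d))))
      l (𝓝 (∫ z, b₀ z ∂((ν' : Measure (State d)).prod (ν' : Measure (State d))))) := by
    have h := (ProbabilityMeasure.continuous_prod.tendsto (ν', ν')).comp (hlim.prodMk_nhds hlim)
    let g : BoundedContinuousFunction (State d × State d) ℝ :=
      BoundedContinuousFunction.ofNormedAddCommGroup b₀ hb₀c N hb₀N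
    exact ProbabilityMeasure.tendsto_iff_forall_integral_tendsto.1 h g
  have hloc : ∀ᶠ i in l, ∀ z : State d × State d, ‖z.1‖ ≤ 2 * r → ‖z.2‖ ≤ 2 * r →
      ‖b i z - b' z‖ ≤ η / 3 := by
    have h := tendstoLocallyUniformly_iff_forall_isCompact.1 hbb
      (Metric.closedBall (0 : State d) (2 * r) ×ˢ Metric.closedBall (0 : State d) (2 * r))
      ((isCompact_closedBall _ _).prod (isCompact_closedBall _ _))
    filter_upwards [Metric.tendstoUniformlyOn_iff.1 h (η / 3) (by positivity)] with i hi z h1 h2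
    have := (hi z ⟨by simpa using h1, by simpa using h2⟩).le
    rwa [dist_comm, dist_eq_norm] at this
  have hfin := hint ν' hν' b' le_rfl hb'c.measurable hb' (by simp)
  filter_upwards [hν, hbm, hb, hloc, Metric.tendsto_nhds.1 hbdd (η / 3) (by positivity)]
    with i h1 h2 h3 h4 h5
  have h6 := hint (ν i) h1 (b i) (by positivity) h2 h3 h4
  rw [Real.dist_eq] at h5 ⊢
  have h7 : 0 ≤ 1 / ((j : ℝ) + 1) := by positivity
  rw [abs_lt] at h5 ⊢
  rw [abs_le] at h6 hfin
  constructor <;> nlinarith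

/-! ### Smooth compactly supported test functions and tail moments -/

/-- Smooth compactly supported functions separate probability measures. -/
theorem ProbabilityMeasure.ext_of_integral_contDiff {μ ν : ProbabilityMeasure (State d)}
    (h : ∀ φ : State d → ℝ, ContDiff ℝ (⊤ : ℕ∞) φ → HasCompactSupport φ →
      ∫ x, φ x ∂(μ : Measure (State d)) = ∫ x, φ x ∂(ν : Measure (State d))) : μ = ν := by
  -- Both measures have integrable densities with respect to their sum, so the fundamental lemma of
  -- the calculus of variations applies to these densities.
  set m : Measure (State d) := (μ : Measure (State d)) + (ν : Measure (State d)) with hm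
  have : IsFiniteMeasure m := by rw [hm]; infer_instance
  have dμ : (μ : Measure (State d)).HaveLebesgueDecomposition m :=
    Measure.haveLebesgueDecomposition_of_sigmaFinite _ _
  have dν : (ν : Measure (State d)).HaveLebesgueDecomposition m :=
    Measure.haveLebesgueDecomposition_of_sigmaFinite _ _
  have hμ : (μ : Measure (State d)) ≪ m := Measure.AbsolutelyContinuous.rfl.add_right _
  have hν : (ν : Measure (State d)) ≪ m := by
    rw [hm, add_comm]; exact Measure.AbsolutelyContinuous.rfl.add_right _
  have hae : ∀ᵐ x ∂m, ((μ : Measure (State d)).rnDeriv m x).toReal =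
      ((ν : Measure (State d)).rnDeriv m x).toReal := by
    refine ae_eq_of_integral_contDiff_smul_eq Measure.integrable_toReal_rnDeriv.locallyIntegrable
      Measure.integrable_toReal_rnDeriv.locallyIntegrable fun g hg hgc => ?_
    have h1 := integral_rnDeriv_smul hμ (f := g)
    have h2 := integral_rnDeriv_smul hν (f := g)
    simp only [smul_eq_mul] at h1 h2 ⊢
    simp only [mul_comm (g _)]
    rw [h1, h2, h g hg hgc]
  have hae' : (μ : Measure (State d)).rnDeriv m =ᵐ[m] (ν : Measure (State d)).rnDeriv m := by
    filter_upwards [hae, Measure.rnDeriv_lt_top (μ : Measure (State d)) m,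
      Measure.rnDeriv_lt_top (ν : Measure (State d)) m] with x hx h1 h2
    exact (ENNReal.toReal_eq_toReal_iff' h1.ne h2.ne).1 hx
  apply Subtype.ext
  change (μ : Measure (State d)) = (ν : Measure (State d))
  rw [← Measure.withDensity_rnDeriv_eq _ _ hμ, ← Measure.withDensity_rnDeriv_eq _ _ hν,
    withDensity_congr_ae hae']

open scoped Convolution in
/-- Lipschitz functions of compact support are uniform limits of smooth ones, with the same
Lipschitz constant. -/
theorem exists_contDiff_lipschitzWith_approx {L : NNReal} {g : State d → ℝ} (hg : LipschitzWith L g)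
    (hgc : HasCompactSupport g) {δ : ℝ} (hδ : 0 < δ) :
    ∃ φ : State d → ℝ, ContDiff ℝ (⊤ : ℕ∞) φ ∧ HasCompactSupport φ ∧ LipschitzWith L φ ∧
      (∀ x, |φ x - g x| ≤ L * δ) ∧ ∀ x, (∀ y ∈ Metric.ball x δ, g y = 0) → φ x = 0 := by
  -- The normalised bump is a probability density carried by the ball of radius `δ`. Averaging
  -- translates of `g` keeps the Lipschitz constant, moves values by at most `L δ`, and sees only
  -- values of `g` within distance `δ`.
  let ρ : ContDiffBump (0 : State d) := ⟨δ / 2, δ, by positivity, by linarith⟩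
  have hcont := hg.continuous
  have hloc : LocallyIntegrable g (volume : Measure (State d)) := hcont.locallyIntegrable
  have hint (x : State d) : Integrable (fun t => ρ.normed volume t • g (x - t)) := by
    refine (Continuous.integrable_of_hasCompactSupport ?_ ?_)
    · exact (ρ.contDiff_normed (n := 0)).continuous.smul (hcont.comp (by fun_prop))
    · exact ρ.hasCompactSupport_normed.smul_right
  refine ⟨ρ.normed volume ⋆[ContinuousLinearMap.lsmul ℝ ℝ, volume] g, ?_, ?_, ?_, ?_, ?_⟩
  · exact ρ.hasCompactSupport_normed.contDiff_convolution_left _ ρ.contDiff_normed hloc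
  · exact ρ.hasCompactSupport_normed.convolution _ hgc
  · refine LipschitzWith.of_dist_le_mul fun x y => ?_
    rw [dist_eq_norm]
    simp only [convolution, ContinuousLinearMap.lsmul_apply]
    rw [← integral_sub (hint x) (hint y)]
    calc ‖∫ t, (ρ.normed volume t • g (x - t) - ρ.normed volume t • g (y - t))‖
        ≤ ∫ t, ρ.normed volume t * (L * dist x y) := by
          refine norm_integral_le_of_norm_le (ρ.integrable_normed.mul_const _)
            (Eventually.of_forall fun t => ?_)
          rw [← smul_sub, norm_smul, Real.norm_of_nonneg (ρ.nonneg_normed t), ← dist_eq_norm]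
          have h := hg.dist_le_mul (x - t) (y - t)
          rw [dist_sub_right] at h
          exact mul_le_mul_of_nonneg_left h (ρ.nonneg_normed t)
      _ = L * dist x y := by rw [integral_mul_const, ρ.integral_normed, one_mul]
  · intro x
    have h := ρ.dist_normed_convolution_le (μ := (volume : Measure (State d))) (x₀ := x)
      (ε := L * δ) hcont.aestronglyMeasurable (fun y hy => by
        refine (hg.dist_le_mul y x).trans ?_
        exact mul_le_mul_of_nonneg_left (le_of_lt hy) L.coe_nonneg)
    rwa [Real.dist_eq] at h
  · intro x hx
    have h0 : g x = 0 := hx x (Metric.mem_ball_self hδ)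
    rw [ρ.normed_convolution_eq_right (fun y hy => by rw [h0]; exact hx y hy), h0]

/-- The cutoff of `(‖x‖ - r)₊` outside the ball of radius `N`. -/
noncomputable def tent (r N : ℝ) (x : State d) : ℝ := max (min (‖x‖ - r) (N - ‖x‖)) 0

theorem lipschitzWith_tent (r N : ℝ) : LipschitzWith 1 (tent (d := d) r N) := by
  have h1 : LipschitzWith 1 fun x : State d => ‖x‖ - r := by
    simpa using lipschitzWith_one_norm.sub (LipschitzWith.const (α := State d) r)
  have h2 : LipschitzWith 1 fun x : State d => N - ‖x‖ := by
    simpa using (LipschitzWith.const (α := State d) N).sub lipschitzWith_one_norm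
  have h := (h1.min h2).max_const 0
  rw [max_self] at h
  exact h

theorem hasCompactSupport_tent (r N : ℝ) : HasCompactSupport (tent (d := d) r N) := by
  refine HasCompactSupport.intro (isCompact_closedBall (0 : State d) N) fun x hx => ?_
  have : N < ‖x‖ := by simpa using hx
  exact max_eq_right ((min_le_right _ _).trans (by linarith))

theorem abs_tent_sub_tent_le (r N : ℝ) {δ : ℝ} (hδ : 0 ≤ δ) (x : State d) :
    |tent (r + δ) N x - tent r N x| ≤ δ := by
  unfold tent
  refine (abs_max_sub_max_le_abs _ _ _).trans ?_
  rw [abs_le]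
  constructor <;> rcases min_cases (‖x‖ - (r + δ)) (N - ‖x‖) with h | h <;>
    rcases min_cases (‖x‖ - r) (N - ‖x‖) with h' | h' <;> linarith

theorem tent_le (r N : ℝ) (x : State d) : tent r N x ≤ max (‖x‖ - r) 0 :=
  max_le_max (min_le_left _ _) le_rfl

theorem tent_nonneg (r N : ℝ) (x : State d) : 0 ≤ tent r N x := le_max_right _ _

theorem tendsto_integral_tent {ν : ProbabilityMeasure (State d)} (hν : HasFirstMoment ν) (r : ℝ) :
    Tendsto (fun N : ℕ => ∫ x, tent r N x ∂(ν : Measure (State d))) atTop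
      (𝓝 (∫ x, max (‖x‖ - r) 0 ∂(ν : Measure (State d)))) := by
  refine tendsto_integral_of_dominated_convergence (fun x => max (‖x‖ - r) 0)
    (fun N => (lipschitzWith_tent r N).continuous.aestronglyMeasurable) (hν.integrable_max r)
    (fun N => Eventually.of_forall fun x => ?_) (Eventually.of_forall fun x => ?_)
  · rw [Real.norm_of_nonneg (tent_nonneg _ _ _)]; exact tent_le _ _ _
  · obtain ⟨n, hn⟩ := exists_nat_ge (2 * ‖x‖ - r)
    refine tendsto_const_nhds.congr' ?_
    filter_upwards [eventually_ge_atTop n] with N hN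
    have : (n : ℝ) ≤ N := by exact_mod_cast hN
    unfold tent
    rw [min_eq_left (by linarith)]

/-- Tail moments are compared by testing against smooth compactly supported functions. -/
theorem integral_max_le_of_forall_test {ν ν' : ProbabilityMeasure (State d)}
    (hν : HasFirstMoment ν) (hν' : HasFirstMoment ν') {r c : ℝ}
    (h : ∀ φ : State d → ℝ, ContDiff ℝ (⊤ : ℕ∞) φ → HasCompactSupport φ → LipschitzWith 1 φ →
      (∀ x, ‖x‖ ≤ r → φ x = 0) →
      ∫ x, φ x ∂(ν : Measure (State d)) ≤ ∫ x, φ x ∂(ν' : Measure (State d)) + c) :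
    ∫ x, max (‖x‖ - r) 0 ∂(ν : Measure (State d)) ≤
      ∫ x, max (‖x‖ - r) 0 ∂(ν' : Measure (State d)) + c := by
  refine le_of_tendsto_of_tendsto' (tendsto_integral_tent hν r)
    ((tendsto_integral_tent hν' r).add_const c) fun N => ?_
  refine le_of_forall_pos_le_add fun η hη => ?_
  -- Raising the inner radius to `r + δ` makes the function mollified at scale `δ` vanish on `‖x‖ ≤
  -- r`. The shift and the mollification cost `δ` each, for each of the two measures: `4 δ = η`.
  set δ := η / 4 with hδ
  have hδ0 : 0 < δ := by positivity
  obtain ⟨φ, hφ, hφc, hφL, hφa, hφ0⟩ := exists_contDiff_lipschitzWith_approx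
    (lipschitzWith_tent (d := d) (r + δ) N) (hasCompactSupport_tent _ _) hδ0
  have hclose (x : State d) : |φ x - tent r N x| ≤ 2 * δ := by
    calc |φ x - tent r N x| ≤ |φ x - tent (r + δ) N x| + |tent (r + δ) N x - tent r N x| :=
          abs_sub_le _ _ _
      _ ≤ 1 * δ + δ := add_le_add (by simpa using hφa x) (abs_tent_sub_tent_le r N hδ0.le x)
      _ = 2 * δ := by ring
  have h1 := h φ hφ hφc hφL fun x hx => hφ0 x fun y hy => by
    have hy' : ‖y‖ < r + δ := by
      have := norm_sub_norm_le y x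
      rw [Metric.mem_ball, dist_eq_norm] at hy
      linarith
    exact max_eq_right ((min_le_left _ _).trans (by linarith))
  have hint (ρ : ProbabilityMeasure (State d)) : Integrable φ (ρ : Measure (State d)) :=
    hφ.continuous.integrable_of_hasCompactSupport hφc
  have hint' (ρ : ProbabilityMeasure (State d)) :
      Integrable (tent r N) (ρ : Measure (State d)) :=
    (lipschitzWith_tent r N).continuous.integrable_of_hasCompactSupport (hasCompactSupport_tent _ _)
  have h2 (ρ : ProbabilityMeasure (State d)) :
      |∫ x, φ x ∂(ρ : Measure (State d)) - ∫ x, tent r N x ∂(ρ : Measure (State d))| ≤ 2 * δ := by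
    rw [← integral_sub (hint ρ) (hint' ρ)]
    refine (norm_integral_le_of_norm_le_const 
      (Eventually.of_forall fun x => (Real.norm_eq_abs _).trans_le (hclose x))).trans ?_
    simp
  have h3 := abs_le.1 (h2 ν)
  have h4 := abs_le.1 (h2 ν')
  linarith [h3.1, h4.2]

/-! ### Grönwall's inequality by iteration -/

theorem integral_mul_exp_zero (K A t : ℝ) :
    ∫ s in (0 : ℝ)..t, K * (A * Real.exp (K * s)) = A * Real.exp (K * t) - A := by
  have h (s : ℝ) : HasDerivAt (fun s => A * Real.exp (K * s)) (K * (A * Real.exp (K * s))) s := by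
    refine ((((hasDerivAt_id s).const_mul K).exp).const_mul A).congr_deriv ?_
    simp only [id, mul_one]
    ring
  rw [intervalIntegral.integral_eq_sub_of_hasDerivAt (fun s _ => h s)
    (Continuous.intervalIntegrable (by fun_prop) _ _)]
  simp

theorem integral_mul_pow_div_factorial (K M t : ℝ) (n : ℕ) :
    ∫ s in (0 : ℝ)..t, K * (M * (K * s) ^ n / n.factorial) =
      M * (K * t) ^ (n + 1) / (n + 1).factorial := by
  have h (s : ℝ) : HasDerivAt (fun s => M * (K * s) ^ (n + 1) / (n + 1).factorial)
      (K * (M * (K * s) ^ n / n.factorial)) s := by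
    refine (((((hasDerivAt_id s).const_mul K).pow (n + 1)).const_mul M).div_const
      ((n + 1).factorial : ℝ)).congr_deriv ?_
    have h1 : (n.factorial : ℝ) ≠ 0 := by positivity
    have h2 : (n : ℝ) + 1 ≠ 0 := by positivity
    rw [Nat.factorial_succ]
    push_cast
    simp only [id, mul_one]
    field_simp
  rw [intervalIntegral.integral_eq_sub_of_hasDerivAt (fun s _ => h s)
    (Continuous.intervalIntegrable (by fun_prop) _ _)]
  simp

theorem tendsto_mul_pow_div_factorial (M c : ℝ) :
    Tendsto (fun n : ℕ => M * c ^ n / n.factorial) atTop (𝓝 0) := by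
  have := (FloorSemiring.tendsto_pow_div_factorial_atTop c).const_mul M
  simpa [mul_div_assoc] using this

/-- Grönwall's inequality in integral form, for an integrable function. -/
theorem le_mul_exp_of_le_add_integral {T A K : ℝ} (hA : 0 ≤ A) (hK : 0 ≤ K) {y : ℝ → ℝ}
    (hy : IntegrableOn y (Icc 0 T))
    (h : ∀ t ∈ Icc 0 T, y t ≤ A + K * ∫ s in (0 : ℝ)..t, y s) :
    ∀ t ∈ Icc 0 T, y t ≤ A * Real.exp (K * t) := by
  set M := A + K * ∫ s in Icc 0 T, |y s| with hM
  have hyt (t : ℝ) (ht : t ∈ Icc 0 T) : IntervalIntegrable y volume 0 t := by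
    rw [intervalIntegrable_iff_integrableOn_Icc_of_le ht.1]
    exact hy.mono_set (Icc_subset_Icc le_rfl ht.2)
  -- Inserted in the integral inequality, `A exp (K t)` reproduces itself and the remainder becomes
  -- the next Taylor term. `M` is the crude bound that starts the iteration; integrability of `y` is
  -- enough.
  have key (n : ℕ) : ∀ t ∈ Icc 0 T, y t ≤ A * Real.exp (K * t) + M * (K * t) ^ n / n.factorial := by
    induction n with
    | zero =>
      intro t ht
      have h1 : ∫ s in (0 : ℝ)..t, y s ≤ ∫ s in Icc 0 T, |y s| := by
        rw [intervalIntegral.integral_of_le ht.1]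
        calc ∫ s in Ioc 0 t, y s ≤ ∫ s in Ioc 0 t, |y s| := by
              have : IntegrableOn y (Ioc 0 t) :=
                hy.mono_set (Ioc_subset_Icc_self.trans (Icc_subset_Icc le_rfl ht.2))
              exact integral_mono this this.abs fun s => le_abs_self _
          _ ≤ _ := setIntegral_mono_set hy.abs (Eventually.of_forall fun s => abs_nonneg _)
              (Ioc_subset_Icc_self.trans (Icc_subset_Icc le_rfl ht.2)).eventuallyLE
      have h2 := h t ht
      have h3 := mul_le_mul_of_nonneg_left h1 hK
      have h4 : 0 ≤ A * Real.exp (K * t) := by positivity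
      simp only [pow_zero, Nat.factorial_zero, Nat.cast_one, div_one, mul_one]
      linarith
    | succ n ih =>
      intro t ht
      refine (h t ht).trans ?_
      have hi1 : IntervalIntegrable (fun s => K * (A * Real.exp (K * s))) volume 0 t :=
        Continuous.intervalIntegrable (by fun_prop) _ _
      have hi2 : IntervalIntegrable (fun s => K * (M * (K * s) ^ n / n.factorial)) volume 0 t :=
        Continuous.intervalIntegrable (by fun_prop) _ _
      have h1 : K * ∫ s in (0 : ℝ)..t, y s ≤
          ∫ s in (0 : ℝ)..t, (K * (A * Real.exp (K * s)) + K * (M * (K * s) ^ n / n.factorial)) := by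
        rw [← intervalIntegral.integral_const_mul]
        refine intervalIntegral.integral_mono_on ht.1 ((hyt t ht).const_mul K) (hi1.add hi2)
          fun s hs => ?_
        rw [← mul_add]
        exact mul_le_mul_of_nonneg_left (ih s ⟨hs.1, hs.2.trans ht.2⟩) hK
      rw [intervalIntegral.integral_add hi1 hi2, integral_mul_exp_zero,
        integral_mul_pow_div_factorial] at h1
      linarith
  intro t ht
  have hlim := (tendsto_mul_pow_div_factorial M (K * t)).const_add (A * Real.exp (K * t))
  rw [add_zero] at hlim
  exact ge_of_tendsto' hlim fun n => key n t ht

end KineticControl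

/-! ### Collision dynamics and uniform moment bounds -/

namespace KineticControl

variable {d : ℕ} {ι : Type*} [Fintype ι]

/-- A finite family of velocities `k i`, chosen with probabilities `w i`, of linear growth. -/
structure IsVelocityFamily (C : ℝ) (w : ι → ℝ) (k : ι → State d × State d → State d) : Prop where
  nonneg : ∀ i, 0 ≤ w i
  sum_eq_one : ∑ i, w i = 1
  measurable : ∀ i, Measurable (k i)
  growth : ∀ i z, ‖k i z‖ ≤ C * (1 + ‖z.1‖ + ‖z.2‖)

/-- The mean rate of change of the observable `φ` in a collision of strength `α`. -/
noncomputable def collision (w : ι → ℝ) (k : ι → State d × State d → State d) (α : ℝ)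
    (φ : State d → ℝ) (z : State d × State d) : ℝ :=
  ∑ i, w i * (α⁻¹ * (φ (z.1 + α • k i z) - φ z.1))

/-- Weak solutions of the collision dynamics with velocities `k i`. -/
structure IsCollisionSolution (w : ι → ℝ) (k : ι → State d × State d → State d) (α T : ℝ)
    (μ₀ : ProbabilityMeasure (State d)) (ν : ℝ → ProbabilityMeasure (State d)) : Prop where
  memL2P1 : MemL2P1 T ν
  initial : ν 0 = μ₀
  weak : ∀ φ : State d → ℝ, ContDiff ℝ (⊤ : ℕ∞) φ → HasCompactSupport φ → ∀ t ∈ Icc 0 T,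
    HasDerivWithinAt (fun s => ∫ x, φ x ∂(ν s : Measure (State d)))
      (∫ z, collision w k α φ z ∂((ν t : Measure (State d)).prod (ν t : Measure (State d))))
      (Icc 0 T) t

namespace IsVelocityFamily

variable {C : ℝ} {w : ι → ℝ} {k : ι → State d × State d → State d}

theorem const_nonneg (h : IsVelocityFamily C w k) : 0 ≤ C := by
  obtain ⟨i⟩ : Nonempty ι := by
    by_contra hι
    rw [not_nonempty_iff] at hι
    simpa using h.sum_eq_one
  simpa using (norm_nonneg _).trans (h.growth i 0)

theorem abs_sum_le (h : IsVelocityFamily C w k) {f : ι → ℝ} {c : ℝ} (hf : ∀ i, |f i| ≤ c) :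
    |∑ i, w i * f i| ≤ c := by
  calc |∑ i, w i * f i| ≤ ∑ i, |w i * f i| := Finset.abs_sum_le_sum_abs _ _
    _ ≤ ∑ i, w i * c := Finset.sum_le_sum fun i _ => by
        rw [abs_mul, abs_of_nonneg (h.nonneg i)]
        exact mul_le_mul_of_nonneg_left (hf i) (h.nonneg i)
    _ = c := by rw [← Finset.sum_mul, h.sum_eq_one, one_mul]

theorem measurable_collision (h : IsVelocityFamily C w k) (α : ℝ) {φ : State d → ℝ}
    (hφ : Continuous φ) : Measurable (collision w k α φ) := by
  unfold collision
  refine Finset.measurable_sum _ fun i _ => ?_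
  have h1 : Measurable fun z : State d × State d => z.1 + α • k i z :=
    measurable_fst.add ((h.measurable i).const_smul α)
  have h2 : Measurable fun z : State d × State d => φ (z.1 + α • k i z) := hφ.measurable.comp h1
  have h3 : Measurable fun z : State d × State d => φ z.1 := hφ.measurable.comp measurable_fst
  exact ((h2.sub h3).const_mul _).const_mul _

/-- A jump has length `α ‖k i z‖`, which cancels the factor `α⁻¹`; the bound is therefore uniform in
the strength. -/
theorem abs_collision_le (h : IsVelocityFamily C w k) {α : ℝ} (hα : 0 < α) {φ : State d → ℝ}
    {L : NNReal} (hφ : LipschitzWith L φ) (z : State d × State d) :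
    ‖collision w k α φ z‖ ≤ L * C * (1 + ‖z.1‖ + ‖z.2‖) := by
  refine h.abs_sum_le fun i => ?_
  have h1 := hφ.dist_le_mul (z.1 + α • k i z) z.1
  rw [Real.dist_eq, dist_eq_norm, add_sub_cancel_left, norm_smul, Real.norm_of_nonneg hα.le] at h1
  rw [abs_mul, abs_of_pos (inv_pos.2 hα), mul_assoc]
  calc α⁻¹ * |φ (z.1 + α • k i z) - φ z.1| ≤ α⁻¹ * (L * (α * ‖k i z‖)) := by gcongr
    _ = L * ‖k i z‖ := by field_simp
    _ ≤ _ := by gcongr; exact h.growth i z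

/-- An observable that vanishes on a large ball only feels the excess of the pair of states over a
smaller radius. -/
theorem abs_collision_le_excess (h : IsVelocityFamily C w k) {α A : ℝ} (hα : 0 < α) (hαA : α ≤ A)
    {φ : State d → ℝ} (hφ : LipschitzWith 1 φ) {r r' : ℝ} (hr : 1 ≤ r)
    (hr' : 2 * r * (1 + 3 * A * C) ≤ r') (hφ0 : ∀ x, ‖x‖ ≤ r' → φ x = 0) (z : State d × State d) :
    ‖collision w k α φ z‖ ≤ 6 * C * excess r z := by
  have hC := h.const_nonneg
  have hA : 0 ≤ A := hα.le.trans hαA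
  by_cases hz : ‖z.1‖ ≤ 2 * r ∧ ‖z.2‖ ≤ 2 * r
  · have hAC : 0 ≤ A * C := by positivity
    -- From the ball of radius `2 r` a jump has length at most `A C (1 + 4 r) ≤ 6 A C r`, so it ends
    -- within radius `2 r (1 + 3 A C) ≤ r'`, where `φ` vanishes.
    have h0 : collision w k α φ z = 0 := by
      refine Finset.sum_eq_zero fun i _ => ?_
      rw [hφ0 z.1 (hz.1.trans (by nlinarith)), hφ0 (z.1 + α • k i z)]
      · simp
      · calc ‖z.1 + α • k i z‖ ≤ ‖z.1‖ + ‖α • k i z‖ := norm_add_le _ _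
          _ = ‖z.1‖ + α * ‖k i z‖ := by rw [norm_smul, Real.norm_of_nonneg hα.le]
          _ ≤ 2 * r + A * (C * (1 + ‖z.1‖ + ‖z.2‖)) := by
              gcongr
              · exact hz.1
              · exact h.growth i z
          _ ≤ 2 * r + A * (C * (6 * r)) := by
              have : 1 + ‖z.1‖ + ‖z.2‖ ≤ 6 * r := by linarith
              gcongr
          _ ≤ r' := by linarith
    rw [h0, norm_zero]
    exact mul_nonneg (by positivity) (excess_nonneg _ _)
  · rw [not_and_or, not_le, not_le] at hz
    calc ‖collision w k α φ z‖ ≤ (1 : NNReal) * C * (1 + ‖z.1‖ + ‖z.2‖) :=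
          h.abs_collision_le hα hφ z
      _ ≤ (1 : NNReal) * C * (6 * excess r z) := by gcongr; exact growth_le_excess hr hz
      _ = 6 * C * excess r z := by push_cast; ring

theorem abs_integral_collision_le (h : IsVelocityFamily C w k) {α : ℝ} (hα : 0 < α)
    {φ : State d → ℝ} {L : NNReal} (hφ : LipschitzWith L φ) {ν : ProbabilityMeasure (State d)}
    (hν : HasFirstMoment ν) :
    |∫ z, collision w k α φ z ∂((ν : Measure (State d)).prod (ν : Measure (State d)))| ≤
      L * C * (1 + 2 * ∫ x, ‖x‖ ∂(ν : Measure (State d))) := by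
  have h1 : Integrable (fun z : State d × State d => 1 + ‖z.1‖)
      ((ν : Measure (State d)).prod (ν : Measure (State d))) :=
    (integrable_const 1).add hν.integrable_fst
  refine (norm_integral_le_of_norm_le ((h1.add
    hν.integrable_snd).const_mul (L * C))
    (Eventually.of_forall fun z => h.abs_collision_le hα hφ z)).trans_eq ?_
  simp only [Pi.add_apply]
  rw [integral_const_mul,
    integral_add h1 hν.integrable_snd, integral_add (integrable_const 1) hν.integrable_fst,
    integral_comp_fst_self ν fun x => ‖x‖, integral_comp_snd_self ν fun x => ‖x‖]
  simp only [integral_const, probReal_univ, smul_eq_mul, one_mul]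
  ring

theorem abs_integral_collision_le_tail (h : IsVelocityFamily C w k) {α A : ℝ} (hα : 0 < α)
    (hαA : α ≤ A) {φ : State d → ℝ} (hφ : LipschitzWith 1 φ) {r r' : ℝ} (hr : 1 ≤ r)
    (hr' : 2 * r * (1 + 3 * A * C) ≤ r') (hφ0 : ∀ x, ‖x‖ ≤ r' → φ x = 0)
    {ν : ProbabilityMeasure (State d)} (hν : HasFirstMoment ν) :
    |∫ z, collision w k α φ z ∂((ν : Measure (State d)).prod (ν : Measure (State d)))| ≤
      12 * C * ∫ x, max (‖x‖ - r) 0 ∂(ν : Measure (State d)) := by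
  refine (norm_integral_le_of_norm_le ((hν.integrable_excess r).const_mul (6 * C))
    (Eventually.of_forall fun z => h.abs_collision_le_excess hα hαA hφ hr hr' hφ0 z)).trans_eq ?_
  rw [integral_const_mul, hν.integral_excess]
  ring

end IsVelocityFamily

namespace IsCollisionSolution

variable {w : ι → ℝ} {k : ι → State d × State d → State d} {α T : ℝ}
  {μ₀ : ProbabilityMeasure (State d)} {ν : ℝ → ProbabilityMeasure (State d)}

theorem continuousOn (h : IsCollisionSolution w k α T μ₀ ν) {φ : State d → ℝ}
    (hφ : ContDiff ℝ (⊤ : ℕ∞) φ) (hφc : HasCompactSupport φ) :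
    ContinuousOn (fun s => ∫ x, φ x ∂(ν s : Measure (State d))) (Icc 0 T) :=
  fun t ht => (h.weak φ hφ hφc t ht).continuousWithinAt

theorem hasDerivAt (h : IsCollisionSolution w k α T μ₀ ν) {φ : State d → ℝ}
    (hφ : ContDiff ℝ (⊤ : ℕ∞) φ) (hφc : HasCompactSupport φ) {t : ℝ} (ht : t ∈ Ioo 0 T) :
    HasDerivAt (fun s => ∫ x, φ x ∂(ν s : Measure (State d)))
      (∫ z, collision w k α φ z ∂((ν t : Measure (State d)).prod (ν t : Measure (State d)))) t :=
  (h.weak φ hφ hφc t (Ioo_subset_Icc_self ht)).hasDerivAt (Icc_mem_nhds ht.1 ht.2)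

/-- A bound on the collision operator for observables vanishing on a ball bounds the growth of the
tail moment. -/
theorem integral_max_le (h : IsCollisionSolution w k α T μ₀ ν) {r : ℝ} {β : ℝ → ℝ} {t : ℝ}
    (ht : t ∈ Icc 0 T) (hβ : IntegrableOn β (Icc 0 t))
    (hb : ∀ φ : State d → ℝ, ContDiff ℝ (⊤ : ℕ∞) φ → HasCompactSupport φ → LipschitzWith 1 φ →
      (∀ x, ‖x‖ ≤ r → φ x = 0) → ∀ s ∈ Icc 0 t,
      ∫ z, collision w k α φ z ∂((ν s : Measure (State d)).prod (ν s : Measure (State d))) ≤ β s) :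
    ∫ x, max (‖x‖ - r) 0 ∂(ν t : Measure (State d)) ≤
      ∫ x, max (‖x‖ - r) 0 ∂(μ₀ : Measure (State d)) + ∫ s in (0 : ℝ)..t, β s := by
  have h0 : (0 : ℝ) ∈ Icc 0 T := ⟨le_rfl, ht.1.trans ht.2⟩
  have hsub : Icc 0 t ⊆ Icc 0 T := Icc_subset_Icc le_rfl ht.2
  refine integral_max_le_of_forall_test (h.memL2P1.1 t ht) (h.initial ▸ h.memL2P1.1 0 h0)
    fun φ hφ hφc hφL hφ0 => ?_
  have key := intervalIntegral.sub_le_integral_of_hasDeriv_right_of_le ht.1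
    ((h.continuousOn hφ hφc).mono hsub)
    (fun s hs => (h.hasDerivAt hφ hφc ⟨hs.1, hs.2.trans_le ht.2⟩).hasDerivWithinAt) hβ
    fun s hs => hb φ hφ hφc hφL hφ0 s (Ioo_subset_Icc_self hs)
  rw [h.initial] at key
  linarith

variable {C : ℝ}

theorem integrableOn_moment (h : IsCollisionSolution w k α T μ₀ ν) :
    IntegrableOn (fun t => ∫ x, ‖x‖ ∂(ν t : Measure (State d))) (Icc 0 T) :=
  h.memL2P1.2.integrable one_le_two

/-- Grönwall for `1 + 2 m(t)`, with `m` the first moment: the tail estimate at radius `0` gives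
`m(t) ≤ m(0) + C ∫ (1 + 2 m)`. The integrability in time that it needs comes from `MemL2P1`. The
bound does not depend on `α`. -/
theorem moment_le (h : IsCollisionSolution w k α T μ₀ ν) (hk : IsVelocityFamily C w k)
    (hα : 0 < α) {t : ℝ} (ht : t ∈ Icc 0 T) :
    ∫ x, ‖x‖ ∂(ν t : Measure (State d)) ≤
      (1 + 2 * ∫ x, ‖x‖ ∂(μ₀ : Measure (State d))) * Real.exp (2 * C * T) := by
  have hC := hk.const_nonneg
  have hmax (ρ : ProbabilityMeasure (State d)) :
      ∫ x, max (‖x‖ - 0) 0 ∂(ρ : Measure (State d)) = ∫ x, ‖x‖ ∂(ρ : Measure (State d)) :=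
    integral_congr_ae (Eventually.of_forall fun x => by simp)
  have hy : IntegrableOn (fun t => 1 + 2 * ∫ x, ‖x‖ ∂(ν t : Measure (State d))) (Icc 0 T) :=
    (integrableOn_const (by simp)).add (h.integrableOn_moment.const_mul 2)
  have hm (ρ : ProbabilityMeasure (State d)) : 0 ≤ ∫ x, ‖x‖ ∂(ρ : Measure (State d)) :=
    integral_nonneg fun x => norm_nonneg x
  have key := le_mul_exp_of_le_add_integral
    (A := 1 + 2 * ∫ x, ‖x‖ ∂(μ₀ : Measure (State d))) (K := 2 * C)
    (by linarith [hm μ₀]) (by positivity) hy (fun t ht => ?_) t ht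
  · have h1 : Real.exp (2 * C * t) ≤ Real.exp (2 * C * T) := by
      rw [Real.exp_le_exp]; exact mul_le_mul_of_nonneg_left ht.2 (by positivity)
    have h2 := mul_le_mul_of_nonneg_left h1
      (by linarith [hm μ₀] : 0 ≤ 1 + 2 * ∫ x, ‖x‖ ∂(μ₀ : Measure (State d)))
    linarith [hm (ν t)]
  · have hyt := hy.mono_set (Icc_subset_Icc le_rfl ht.2)
    have h1 := h.integral_max_le (r := 0) ht (hyt.const_mul C)
      fun φ hφ hφc hφL _ s hs => by
        have h2 := hk.abs_integral_collision_le hα hφL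
          (h.memL2P1.1 s ⟨hs.1, hs.2.trans ht.2⟩)
        rw [NNReal.coe_one, one_mul] at h2
        exact (le_abs_self _).trans h2
    rw [hmax, hmax, intervalIntegral.integral_const_mul] at h1
    linarith

end IsCollisionSolution

/-! ### Propagation of uniform integrability -/

theorem tendsto_integral_max {ν : ProbabilityMeasure (State d)} (hν : HasFirstMoment ν) :
    Tendsto (fun r : ℝ => ∫ x, max (‖x‖ - r) 0 ∂(ν : Measure (State d))) atTop (𝓝 0) := by
  have h0 : ∫ _, (0 : ℝ) ∂(ν : Measure (State d)) = 0 := integral_zero _ _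
  suffices h : Tendsto (fun r : ℝ => ∫ x, max (‖x‖ - r) 0 ∂(ν : Measure (State d))) atTop
      (𝓝 (∫ _, (0 : ℝ) ∂(ν : Measure (State d)))) by rwa [h0] at h
  clear h0
  refine tendsto_integral_filter_of_dominated_convergence (fun x => ‖x‖)
    (Eventually.of_forall fun r => by fun_prop) ?_ hν (Eventually.of_forall fun x => ?_)
  · filter_upwards [eventually_ge_atTop 0] with r hr
    refine Eventually.of_forall fun x => ?_
    rw [Real.norm_of_nonneg (le_max_right _ _)]
    exact max_le (by linarith) (norm_nonneg x)
  · refine tendsto_const_nhds.congr' ?_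
    filter_upwards [eventually_ge_atTop ‖x‖] with r hr
    exact (max_eq_right (by linarith)).symm

/-- Uniform integrability of the first moments is propagated by the collision dynamics. -/
theorem exists_radius_integral_max_le (C A T : ℝ)
    {μ₀ : ProbabilityMeasure (State d)}
    (hμ₀ : HasFirstMoment μ₀) {δ : ℝ} (hδ : 0 < δ) :
    ∃ r : ℝ, 1 ≤ r ∧ ∀ (w : ι → ℝ) (k : ι → State d × State d → State d) (α : ℝ)
      (ν : ℝ → ProbabilityMeasure (State d)), 0 < α → α ≤ A → IsVelocityFamily C w k →
      IsCollisionSolution w k α T μ₀ ν → ∀ t ∈ Icc 0 T,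
      ∫ x, max (‖x‖ - r) 0 ∂(ν t : Measure (State d)) ≤ δ := by
  by_cases hC : 0 ≤ C
  swap
  · exact ⟨1, le_rfl, fun w k α ν _ _ hk => absurd hk.const_nonneg hC⟩
  by_cases hT : 0 ≤ T
  swap
  · exact ⟨1, le_rfl, fun w k α ν _ _ _ _ t ht => absurd (ht.1.trans ht.2) hT⟩
  set M := (1 + 2 * ∫ x, ‖x‖ ∂(μ₀ : Measure (State d))) * Real.exp (2 * C * T)
  set K := 12 * C with hK
  have hK0 : 0 ≤ K := by positivity
  -- The tail at one radius is controlled by the tail at a smaller one, so Grönwall at a fixed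
  -- radius is not available. Each induction step enlarges the radius, which has to be chosen before
  -- the solution to be uniform in it.
  have key (n : ℕ) : ∀ δ : ℝ, 0 < δ →
      ∃ r : ℝ, 1 ≤ r ∧ ∀ (w : ι → ℝ) (k : ι → State d × State d → State d) (α : ℝ)
      (ν : ℝ → ProbabilityMeasure (State d)), 0 < α → α ≤ A → IsVelocityFamily C w k →
      IsCollisionSolution w k α T μ₀ ν → ∀ t ∈ Icc 0 T,
      ∫ x, max (‖x‖ - r) 0 ∂(ν t : Measure (State d)) ≤ δ + M * (K * t) ^ n / n.factorial := by
    induction n with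
    | zero =>
      intro δ hδ
      refine ⟨1, le_rfl, fun w k α ν hα _ hk hν t ht => ?_⟩
      have h1 := hν.moment_le hk hα ht
      have h2 : ∫ x, max (‖x‖ - 1) 0 ∂(ν t : Measure (State d)) ≤
          ∫ x, ‖x‖ ∂(ν t : Measure (State d)) :=
        integral_mono ((hν.memL2P1.1 t ht).integrable_max 1) (hν.memL2P1.1 t ht)
          fun x => max_le (by linarith [norm_nonneg x]) (norm_nonneg x)
      simp only [pow_zero, Nat.factorial_zero, Nat.cast_one, div_one, mul_one]
      linarith
    | succ n ih =>
      intro δ hδ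
      have hKT : 0 < 1 + K * T := by positivity
      -- The error of the previous step, integrated in time, costs at most `K T δ' ≤ δ / 2`; the
      -- other `δ / 2` is the tail of `μ₀`.
      set δ' := δ / (2 * (1 + K * T)) with hδ'
      obtain ⟨r₁, hr₁, h₁⟩ := ih δ' (by positivity)
      obtain ⟨r₀, hr₀⟩ := ((tendsto_integral_max hμ₀).eventually
        (gt_mem_nhds (half_pos hδ))).exists_forall_of_atTop
      -- Large enough to hide collisions inside the ball of radius `2 r₁`, to make the tail of `μ₀`
      -- small, and to be at least `1`.
      refine ⟨max (2 * r₁ * (1 + 3 * A * C)) (max r₀ 1),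
        (le_max_right _ _).trans (le_max_right _ _), fun w k α ν hα hαA hk hν t ht => ?_⟩
      have hi1 : IntervalIntegrable (fun _ : ℝ => K * δ') volume 0 t :=
        Continuous.intervalIntegrable (by fun_prop) _ _
      have hi2 : IntervalIntegrable (fun s => K * (M * (K * s) ^ n / n.factorial)) volume 0 t :=
        Continuous.intervalIntegrable (by fun_prop) _ _
      have h2 := hν.integral_max_le (r := max (2 * r₁ * (1 + 3 * A * C)) (max r₀ 1)) ht
        (β := fun s => K * δ' + K * (M * (K * s) ^ n / n.factorial))
        ((intervalIntegrable_iff_integrableOn_Icc_of_le ht.1).1 (hi1.add hi2))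
        fun φ hφ hφc hφL hφ0 s hs => by
          have hs' : s ∈ Icc 0 T := ⟨hs.1, hs.2.trans ht.2⟩
          refine (le_abs_self _).trans ((hk.abs_integral_collision_le_tail hα hαA hφL hr₁
            (le_max_left _ _) hφ0 (hν.memL2P1.1 s hs')).trans ?_)
          rw [← mul_add]
          exact mul_le_mul_of_nonneg_left (h₁ w k α ν hα hαA hk hν s hs') hK0
      rw [intervalIntegral.integral_add hi1 hi2, integral_mul_pow_div_factorial,
        intervalIntegral.integral_const, sub_zero, smul_eq_mul] at h2
      have h3 := hr₀ _ ((le_max_left _ _).trans (le_max_right (2 * r₁ * (1 + 3 * A * C))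
        (max r₀ 1)))
      have h4 : t * (K * δ') ≤ δ / 2 := by
        have h5 : t * (K * δ') ≤ T * (K * δ') :=
          mul_le_mul_of_nonneg_right ht.2 (by positivity)
        have h6 : (1 + K * T) * δ' = δ / 2 := by rw [hδ']; field_simp
        have h7 : 0 < δ' := by positivity
        nlinarith
      linarith
  obtain ⟨n, hn⟩ := ((tendsto_mul_pow_div_factorial M (K * T)).eventually
    (gt_mem_nhds (half_pos hδ))).exists
  obtain ⟨r, hr, h⟩ := key n (δ / 2) (half_pos hδ)
  refine ⟨r, hr, fun w k α ν hα hαA hk hν t ht => (h w k α ν hα hαA hk hν t ht).trans ?_⟩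
  have hM : 0 ≤ M := by
    have : 0 ≤ ∫ x, ‖x‖ ∂(μ₀ : Measure (State d)) := integral_nonneg fun x => norm_nonneg x
    positivity
  have : M * (K * t) ^ n / n.factorial ≤ M * (K * T) ^ n / n.factorial := by
    have h0 : 0 ≤ K * t := mul_nonneg hK0 ht.1
    gcongr
    exact ht.2
  linarith

/-- Solutions with the same initial datum stay in a common compact set. -/
theorem exists_tailSet (C A T : ℝ) {μ₀ : ProbabilityMeasure (State d)}
    (hμ₀ : HasFirstMoment μ₀) :
    ∃ R : ℕ → ℝ, (∀ j, 1 ≤ R j) ∧ ∀ (w : ι → ℝ) (k : ι → State d × State d → State d) (α : ℝ)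
      (ν : ℝ → ProbabilityMeasure (State d)), 0 < α → α ≤ A → IsVelocityFamily C w k →
      IsCollisionSolution w k α T μ₀ ν → ∀ t ∈ Icc 0 T, ν t ∈ tailSet R := by
  choose R hR h using fun j : ℕ => exists_radius_integral_max_le (ι := ι) C A T hμ₀
    (δ := 1 / ((j : ℝ) + 1)) (by positivity)
  exact ⟨R, hR, fun w k α ν hα hαA hk hν t ht =>
    mem_tailSet_iff.2 ⟨hν.memL2P1.1 t ht, fun j => h j w k α ν hα hαA hk hν t ht⟩⟩

end KineticControl

/-! ### Consistency of the collision rate with the flux -/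

namespace KineticControl

variable {d : ℕ} {ι : Type*} [Fintype ι]

/-- The mean directional derivative of `φ` along the velocities `k i`. -/
noncomputable def flux (w : ι → ℝ) (k : ι → State d × State d → State d)
    (φ : State d → ℝ) (z : State d × State d) : ℝ :=
  ∑ i, w i * fderiv ℝ φ z.1 (k i z)

/-- The mean value inequality on the segment from `x` to `x + α v` bounds the Taylor remainder, and
replacing `v` by `v'` in the derivative costs `L ‖v - v'‖`. In use, `v` is the velocity at strength
`α` and `v'` its limit. -/
theorem abs_difference_quotient_sub_le {φ : State d → ℝ} (hφ : ContDiff ℝ (⊤ : ℕ∞) φ)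
    {L L' : NNReal} (hL : LipschitzWith L φ) (hL' : LipschitzWith L' (fderiv ℝ φ)) {α : ℝ}
    (hα : 0 < α) (x v v' : State d) :
    |α⁻¹ * (φ (x + α • v) - φ x) - fderiv ℝ φ x v'| ≤ L' * α * ‖v‖ ^ 2 + L * ‖v - v'‖ := by
  have h1 : ‖φ (x + α • v) - φ x - fderiv ℝ φ x (x + α • v - x)‖ ≤
      L' * ‖α • v‖ * ‖x + α • v - x‖ := by
    refine (convex_segment x (x + α • v)).norm_image_sub_le_of_norm_fderiv_le' (𝕜 := ℝ)
      (fun y _ => hφ.differentiable (by simp) y) (fun y hy => ?_) (left_mem_segment _ _ _)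
      (right_mem_segment _ _ _)
    rw [← dist_eq_norm]
    refine (hL'.dist_le_mul _ _).trans ?_
    gcongr
    rw [dist_eq_norm]
    have := norm_sub_le_of_mem_segment hy
    rwa [add_sub_cancel_left] at this
  rw [add_sub_cancel_left, norm_smul, Real.norm_of_nonneg hα.le, map_smul, smul_eq_mul,
    Real.norm_eq_abs] at h1
  have h2 : |fderiv ℝ φ x (v - v')| ≤ L * ‖v - v'‖ :=
    ((fderiv ℝ φ x).le_opNorm _).trans
      (mul_le_mul_of_nonneg_right (norm_fderiv_le_of_lipschitz ℝ hL) (norm_nonneg _))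
  have h3 : α⁻¹ * (φ (x + α • v) - φ x) - fderiv ℝ φ x v' =
      α⁻¹ * (φ (x + α • v) - φ x - α * fderiv ℝ φ x v) + fderiv ℝ φ x (v - v') := by
    rw [map_sub]; field_simp; ring
  rw [h3]
  refine (abs_add_le _ _).trans (add_le_add ?_ h2)
  rw [abs_mul, abs_of_pos (inv_pos.2 hα)]
  calc α⁻¹ * |φ (x + α • v) - φ x - α * fderiv ℝ φ x v|
      ≤ α⁻¹ * (L' * (α * ‖v‖) * (α * ‖v‖)) := by gcongr
    _ = L' * α * ‖v‖ ^ 2 := by field_simp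

/-- In the quasi-invariant limit the collision rate converges to the flux. -/
theorem tendstoLocallyUniformly_collision {κ : Type*} {l : Filter κ} {C : ℝ} {w : ι → ℝ}
    {k : κ → ι → State d × State d → State d} {k' : ι → State d × State d → State d} {α : κ → ℝ}
    (hα : ∀ n, 0 < α n) (hα0 : Tendsto α l (𝓝 0)) (hk : ∀ n, IsVelocityFamily C w (k n))
    (hkk : ∀ i, TendstoLocallyUniformly (fun n => k n i) (k' i) l) {φ : State d → ℝ}
    (hφ : ContDiff ℝ (⊤ : ℕ∞) φ) (hφc : HasCompactSupport φ) :
    TendstoLocallyUniformly (fun n => collision w (k n) (α n) φ) (flux w k' φ) l := by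
  obtain ⟨L, hL⟩ := ContDiff.lipschitzWith_of_hasCompactSupport hφc hφ (by simp)
  obtain ⟨L', hL'⟩ := ContDiff.lipschitzWith_of_hasCompactSupport (𝕂 := ℝ) (n := (⊤ : ℕ∞))
    (hφc.fderiv (𝕜 := ℝ)) (hφ.fderiv_right (m := (⊤ : ℕ∞)) (by rfl)) (by simp)
  rw [tendstoLocallyUniformly_iff_forall_isCompact]
  intro Z hZ
  obtain ⟨B, hB⟩ := hZ.exists_bound_of_continuousOn (f := fun z : State d × State d =>
    C * (1 + ‖z.1‖ + ‖z.2‖)) (by fun_prop)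
  rw [Metric.tendstoUniformlyOn_iff]
  intro η hη
  have h1 : ∀ᶠ n in l, L' * α n * B ^ 2 < η / 2 := by
    have h := (hα0.const_mul (L' : ℝ)).mul_const (B ^ 2)
    rw [mul_zero, zero_mul] at h
    exact h.eventually (gt_mem_nhds (half_pos hη))
  -- `L + 1` instead of `L` avoids dividing by zero when `φ` is constant.
  have h2 : ∀ᶠ n in l, ∀ i, ∀ z ∈ Z, dist (k' i z) (k n i z) < η / (2 * (L + 1)) := by
    rw [eventually_all]
    intro i
    exact Metric.tendstoUniformlyOn_iff.1
      (tendstoLocallyUniformly_iff_forall_isCompact.1 (hkk i) Z hZ) _ (by positivity)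
  filter_upwards [h1, h2] with n hn1 hn2 z hz
  have hb (i : ι) : ‖k n i z‖ ≤ B :=
    ((hk n).growth i z).trans ((le_abs_self _).trans (hB z hz))
  rw [dist_comm, Real.dist_eq]
  unfold collision flux
  rw [← Finset.sum_sub_distrib]
  simp_rw [← mul_sub]
  refine lt_of_le_of_lt ((hk n).abs_sum_le (c := L' * α n * B ^ 2 + η / 2) fun i => ?_)
    (by linarith)
  refine (abs_difference_quotient_sub_le hφ hL hL' (hα n) _ _ _).trans (add_le_add ?_ ?_)
  · have := (hα n).le
    gcongr
    exact hb i
  · have h3 : ‖k n i z - k' i z‖ ≤ η / (2 * (L + 1)) := by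
      rw [← dist_eq_norm, dist_comm]; exact (hn2 i z hz).le
    calc (L : ℝ) * ‖k n i z - k' i z‖ ≤ (L + 1) * (η / (2 * (L + 1))) := by
          gcongr; linarith
      _ = η / 2 := by field_simp

theorem continuous_flux {w : ι → ℝ} {k : ι → State d × State d → State d}
    (hk : ∀ i, Continuous (k i)) {φ : State d → ℝ} (hφ : ContDiff ℝ (⊤ : ℕ∞) φ) :
    Continuous (flux w k φ) := by
  have h := hφ.continuous_fderiv (by simp)
  unfold flux
  exact continuous_finsetSum _ fun i _ =>
    continuous_const.mul ((h.comp continuous_fst).clm_apply (hk i))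

theorem IsVelocityFamily.abs_flux_le {C : ℝ} {w : ι → ℝ} {k : ι → State d × State d → State d}
    (h : IsVelocityFamily C w k) {φ : State d → ℝ} {L : NNReal} (hφ : LipschitzWith L φ)
    (z : State d × State d) : ‖flux w k φ z‖ ≤ L * C * (1 + ‖z.1‖ + ‖z.2‖) := by
  refine h.abs_sum_le fun i => ((fderiv ℝ φ z.1).le_opNorm _).trans ?_
  rw [mul_assoc]
  exact mul_le_mul (norm_fderiv_le_of_lipschitz ℝ hφ) (h.growth i z) (norm_nonneg _) L.coe_nonneg

theorem continuous_integral_test {φ : State d → ℝ} (hφ : Continuous φ) (hφc : HasCompactSupport φ) :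
    Continuous fun ρ : ProbabilityMeasure (State d) => ∫ x, φ x ∂(ρ : Measure (State d)) := by
  obtain ⟨B, hB⟩ := hφc.exists_bound_of_continuous hφ
  rw [continuous_iff_continuousAt]
  intro ρ
  exact ProbabilityMeasure.tendsto_iff_forall_integral_tendsto.1 tendsto_id
    (BoundedContinuousFunction.ofNormedAddCommGroup φ hφ B hB)

/-- Within measures of uniformly integrable first moments, narrow convergence can be tested on
smooth compactly supported functions. -/
theorem tendsto_of_tendsto_integral_test {κ : Type*} {l : Filter κ} {R : ℕ → ℝ}
    (hR : ∀ j, 1 ≤ R j) {f : κ → ProbabilityMeasure (State d)} {m : ProbabilityMeasure (State d)}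
    (hf : ∀ᶠ i in l, f i ∈ tailSet R)
    (h : ∀ φ : State d → ℝ, ContDiff ℝ (⊤ : ℕ∞) φ → HasCompactSupport φ →
      Tendsto (fun i => ∫ x, φ x ∂(f i : Measure (State d))) l
        (𝓝 (∫ x, φ x ∂(m : Measure (State d))))) : Tendsto f l (𝓝 m) := by
  -- By compactness it is enough to identify the cluster points. The integral of a test function
  -- against a cluster point is a cluster point of a convergent real family, hence equals its limit.
  refine (isCompact_tailSet hR).tendsto_nhds_of_unique_mapClusterPt hf fun x _ hx => ?_
  refine ProbabilityMeasure.ext_of_integral_contDiff fun φ hφ hφc => ?_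
  have h1 := hx.continuousAt_comp (continuous_integral_test hφ.continuous hφc).continuousAt
  have h2 := h φ hφ hφc
  by_contra hne
  exact (disjoint_nhds_nhds.2 hne).mono_right h2 |>.eq_bot ▸ h1.neBot.ne <| rfl

/-! ### Compactness in time and passage to the limit -/

section Limit

variable {C T : ℝ} {w : ι → ℝ} {k : ℕ → ι → State d × State d → State d} {α : ℕ → ℝ}
  {μ₀ : ProbabilityMeasure (State d)}

namespace IsCollisionSolution

variable {k : ι → State d × State d → State d} {α : ℝ} {ν : ℝ → ProbabilityMeasure (State d)}

/-- The bound on the collision operator along a solution, for `L`-Lipschitz observables. -/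
theorem abs_integral_collision_le (h : IsCollisionSolution w k α T μ₀ ν)
    (hk : IsVelocityFamily C w k) (hα : 0 < α) {φ : State d → ℝ} {L : NNReal}
    (hφ : LipschitzWith L φ) {t : ℝ} (ht : t ∈ Icc 0 T) :
    |∫ z, collision w k α φ z ∂((ν t : Measure (State d)).prod (ν t : Measure (State d)))| ≤
      L * C * (1 + 2 * ((1 + 2 * ∫ x, ‖x‖ ∂(μ₀ : Measure (State d))) * Real.exp (2 * C * T))) := by
  refine (hk.abs_integral_collision_le hα hφ (h.memL2P1.1 t ht)).trans ?_
  have := hk.const_nonneg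
  gcongr
  exact h.moment_le hk hα ht

/-- Equicontinuity in time: the Lipschitz constant involves only `L`, `C`, `T` and `μ₀`, not `α`. -/
theorem abs_integral_sub_le (h : IsCollisionSolution w k α T μ₀ ν) (hk : IsVelocityFamily C w k)
    (hα : 0 < α) {φ : State d → ℝ} (hφ : ContDiff ℝ (⊤ : ℕ∞) φ) (hφc : HasCompactSupport φ)
    {L : NNReal} (hL : LipschitzWith L φ) {s t : ℝ} (hs : s ∈ Icc 0 T) (ht : t ∈ Icc 0 T) :
    |∫ x, φ x ∂(ν t : Measure (State d)) - ∫ x, φ x ∂(ν s : Measure (State d))| ≤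
      L * C * (1 + 2 * ((1 + 2 * ∫ x, ‖x‖ ∂(μ₀ : Measure (State d))) * Real.exp (2 * C * T))) *
        |t - s| :=
  (convex_Icc 0 T).norm_image_sub_le_of_norm_hasDerivWithin_le
    (fun r hr => h.weak φ hφ hφc r hr)
    (fun _ hr => h.abs_integral_collision_le hk hα hL hr) hs ht

/-- Measurability in time comes for free: on the open interval the integrand is a derivative. The
moment bound makes it bounded. -/
theorem intervalIntegrable_collision (h : IsCollisionSolution w k α T μ₀ ν)
    (hk : IsVelocityFamily C w k) (hα : 0 < α) {φ : State d → ℝ} (hφ : ContDiff ℝ (⊤ : ℕ∞) φ)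
    (hφc : HasCompactSupport φ) {t : ℝ} (ht : t ∈ Icc 0 T) :
    IntervalIntegrable (fun s => ∫ z, collision w k α φ z
      ∂((ν s : Measure (State d)).prod (ν s : Measure (State d)))) volume 0 t := by
  obtain ⟨L, hL⟩ := ContDiff.lipschitzWith_of_hasCompactSupport hφc hφ (by simp)
  rw [intervalIntegrable_iff_integrableOn_Ioo_of_le ht.1]
  refine (integrable_const _).mono' ?_
    ((ae_restrict_mem measurableSet_Ioo).mono fun s hs =>
      h.abs_integral_collision_le hk hα hL ⟨hs.1.le, hs.2.le.trans ht.2⟩)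
  refine (measurable_deriv fun s => ∫ x, φ x ∂(ν s : Measure (State d))).aestronglyMeasurable.congr
    ((ae_restrict_mem measurableSet_Ioo).mono fun s hs =>
      (h.hasDerivAt hφ hφc ⟨hs.1, hs.2.trans_le ht.2⟩).deriv)

theorem integral_collision_eq (h : IsCollisionSolution w k α T μ₀ ν)
    (hk : IsVelocityFamily C w k) (hα : 0 < α) {φ : State d → ℝ} (hφ : ContDiff ℝ (⊤ : ℕ∞) φ)
    (hφc : HasCompactSupport φ) {t : ℝ} (ht : t ∈ Icc 0 T) :
    ∫ x, φ x ∂(ν t : Measure (State d)) = ∫ x, φ x ∂(μ₀ : Measure (State d)) +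
      ∫ s in (0 : ℝ)..t, ∫ z, collision w k α φ z
        ∂((ν s : Measure (State d)).prod (ν s : Measure (State d))) := by
  rw [intervalIntegral.integral_eq_sub_of_hasDeriv_right_of_le ht.1
    ((h.continuousOn hφ hφc).mono (Icc_subset_Icc le_rfl ht.2))
    (fun s hs => (h.hasDerivAt hφ hφc ⟨hs.1, hs.2.trans_le ht.2⟩).hasDerivWithinAt)
    (h.intervalIntegrable_collision hk hα hφ hφc ht), h.initial]
  ring

end IsCollisionSolution

/-- Compactness: solutions for a sequence of strengths have a subsequence that converges at every
time, to a curve continuous for the narrow topology. -/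
theorem exists_subseq_tendsto (hT : 0 ≤ T) {R : ℕ → ℝ} (hR : ∀ j, 1 ≤ R j)
    {ν : ℕ → ℝ → ProbabilityMeasure (State d)} (hν : ∀ n, ∀ t ∈ Icc 0 T, ν n t ∈ tailSet R)
    (hLip : ∀ φ : State d → ℝ, ContDiff ℝ (⊤ : ℕ∞) φ → HasCompactSupport φ → ∃ B : ℝ, 0 ≤ B ∧
      ∀ n, ∀ s ∈ Icc 0 T, ∀ t ∈ Icc 0 T,
      |∫ x, φ x ∂(ν n t : Measure (State d)) - ∫ x, φ x ∂(ν n s : Measure (State d))| ≤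
        B * |t - s|) :
    ∃ (κ : ℕ → ℕ) (μ : ℝ → ProbabilityMeasure (State d)), StrictMono κ ∧
      (∀ t ∈ Icc 0 T, μ t ∈ tailSet R) ∧
      (∀ t ∈ Icc 0 T, Tendsto (fun n => ν (κ n) t) atTop (𝓝 (μ t))) ∧
      ContinuousOn μ (Icc 0 T) := by
  -- Clamping times to `[0, T]` lets all of `ℚ` serve as the countable dense set of times, end
  -- points included.
  let c : ℝ → ℝ := fun s => (projIcc 0 T hT s : ℝ)
  have hc (s : ℝ) : c s ∈ Icc 0 T := (projIcc 0 T hT s).2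
  obtain ⟨a, -, κ, hκ, ha⟩ := (isCompact_univ_pi fun _ : ℚ => isCompact_tailSet (d := d) hR).tendsto_subseq
    (x := fun n (q : ℚ) => ν n (c q)) fun n q _ => hν n _ (hc q)
  rw [tendsto_pi_nhds] at ha
  have hcauchy (φ : State d → ℝ) (hφ : ContDiff ℝ (⊤ : ℕ∞) φ) (hφc : HasCompactSupport φ) (t : ℝ)
      (ht : t ∈ Icc 0 T) :
      CauchySeq fun n => ∫ x, φ x ∂(ν (κ n) t : Measure (State d)) := by
    obtain ⟨B, hB0, hB⟩ := hLip φ hφ hφc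
    rw [Metric.cauchySeq_iff']
    intro η hη
    obtain ⟨q, hq1, hq2⟩ := exists_rat_btwn
      (show t < t + η / (3 * (B + 1)) by linarith [show 0 < η / (3 * (B + 1)) by positivity])
    have hct : c t = t := by simp only [c, projIcc_of_mem hT ht]
    have hq : |t - c q| ≤ η / (3 * (B + 1)) := by
      have h1 := (LipschitzWith.projIcc (h := hT)).dist_le_mul t q
      rw [Subtype.dist_eq, Real.dist_eq, Real.dist_eq, NNReal.coe_one, one_mul] at h1
      change |c t - c q| ≤ _ at h1
      rw [hct] at h1
      refine h1.trans ?_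
      rw [abs_le]; constructor <;> linarith
    -- The subtracted term is positive, so that two equicontinuity errors and one Cauchy error, each
    -- within `η / 3`, add up to strictly less than `η`.
    have hBq : B * |t - c q| ≤ η / 3 - η / (3 * (B + 1)) := by
      calc B * |t - c q| ≤ B * (η / (3 * (B + 1))) := by gcongr
        _ = η / 3 - η / (3 * (B + 1)) := by field_simp; ring
    have hpos : 0 < η / (3 * (B + 1)) := by positivity
    have h2 := ((continuous_integral_test hφ.continuous hφc).tendsto (a q)).comp (ha q)
    obtain ⟨N, hN⟩ := Metric.cauchySeq_iff'.1 h2.cauchySeq (η / 3) (by positivity)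
    refine ⟨N, fun n hn => ?_⟩
    have h3 := hN n hn
    have h4 := hB (κ n) (c q) (hc q) t ht
    have h5 := hB (κ N) (c q) (hc q) t ht
    simp only [Function.comp_def, Real.dist_eq] at h3 ⊢
    rw [abs_lt] at h3 ⊢
    rw [abs_le] at h4 h5
    constructor <;> linarith
  have hex (t : ℝ) : ∃ m : ProbabilityMeasure (State d), t ∈ Icc 0 T →
      m ∈ tailSet R ∧ Tendsto (fun n => ν (κ n) t) atTop (𝓝 m) := by
    by_cases ht : t ∈ Icc 0 T
    -- A further subsequence depending on `t` only serves to find the limit measure; the Cauchy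
    -- property makes the whole sequence `ν (κ n) t` converge to it.
    · obtain ⟨m, hm, ψ, hψ, hψm⟩ := (isCompact_tailSet hR).tendsto_subseq
        (x := fun n => ν (κ n) t) fun n => hν _ t ht
      refine ⟨m, fun _ => ⟨hm, tendsto_of_tendsto_integral_test hR
        (Eventually.of_forall fun n => hν _ t ht) fun φ hφ hφc => ?_⟩⟩
      exact tendsto_nhds_of_cauchySeq_of_subseq (hcauchy φ hφ hφc t ht) hψ.tendsto_atTop
        (((continuous_integral_test hφ.continuous hφc).tendsto m).comp hψm)
    · exact ⟨ν 0 0, fun h => absurd h ht⟩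
  choose μ hμ using hex
  refine ⟨κ, μ, hκ, fun t ht => (hμ t ht).1, fun t ht => (hμ t ht).2, fun t ht => ?_⟩
  refine tendsto_of_tendsto_integral_test hR
    (eventually_mem_nhdsWithin.mono fun s hs => (hμ s hs).1) fun φ hφ hφc => ?_
  obtain ⟨B, hB0, hB⟩ := hLip φ hφ hφc
  have hlim (s : ℝ) (hs : s ∈ Icc 0 T) :=
    ((continuous_integral_test hφ.continuous hφc).tendsto (μ s)).comp (hμ s hs).2
  have hLμ (s : ℝ) (hs : s ∈ Icc 0 T) :
      |∫ x, φ x ∂(μ s : Measure (State d)) - ∫ x, φ x ∂(μ t : Measure (State d))| ≤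
        B * |s - t| :=
    le_of_tendsto' ((hlim s hs).sub (hlim t ht)).abs fun n => hB (κ n) t ht s hs
  rw [tendsto_iff_dist_tendsto_zero]
  refine squeeze_zero' (Eventually.of_forall fun _ => dist_nonneg)
    (eventually_mem_nhdsWithin.mono fun s hs => hLμ s hs) ?_
  have : Continuous fun s : ℝ => B * |s - t| := by fun_prop
  have h := (this.tendsto t).mono_left (nhdsWithin_le_nhds (s := Icc 0 T))
  simpa using h

/-- The quasi-invariant limit of the collision dynamics. -/
theorem exists_quasiInvariant_limit (hT : 0 ≤ T) (hμ₀ : HasFirstMoment μ₀) (hα : ∀ n, 0 < α n)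
    (hα0 : Tendsto α atTop (𝓝 0)) (hk : ∀ n, IsVelocityFamily C w (k n))
    {k' : ι → State d × State d → State d} (hk' : ∀ i, Continuous (k' i))
    (hkk : ∀ i, TendstoLocallyUniformly (fun n => k n i) (k' i) atTop)
    {ν : ℕ → ℝ → ProbabilityMeasure (State d)}
    (hν : ∀ n, IsCollisionSolution w (k n) (α n) T μ₀ (ν n)) :
    ∃ (κ : ℕ → ℕ) (μ : ℝ → ProbabilityMeasure (State d)), StrictMono κ ∧
      (∀ t ∈ Icc 0 T, Tendsto (fun n => ν (κ n) t) atTop (𝓝 (μ t)) ∧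
        Tendsto (fun n => ∫ x, ‖x‖ ∂(ν (κ n) t : Measure (State d))) atTop
          (𝓝 (∫ x, ‖x‖ ∂(μ t : Measure (State d))))) ∧
      MemL2P1 T μ ∧ μ 0 = μ₀ ∧
      ∀ φ : State d → ℝ, ContDiff ℝ (⊤ : ℕ∞) φ → HasCompactSupport φ →
        ContinuousOn (fun s => ∫ z, flux w k' φ z
          ∂((μ s : Measure (State d)).prod (μ s : Measure (State d)))) (Icc 0 T) ∧
        ∀ t ∈ Icc 0 T, ∫ x, φ x ∂(μ t : Measure (State d)) = ∫ x, φ x ∂(μ₀ : Measure (State d)) +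
          ∫ s in (0 : ℝ)..t, ∫ z, flux w k' φ z
            ∂((μ s : Measure (State d)).prod (μ s : Measure (State d))) := by
  obtain ⟨A, hA⟩ := hα0.bddAbove_range
  have hαA (n : ℕ) : α n ≤ A := hA ⟨n, rfl⟩
  obtain ⟨R, hR, hRν⟩ := exists_tailSet (ι := ι) C A T hμ₀
  have hmem (n : ℕ) : ∀ t ∈ Icc 0 T, ν n t ∈ tailSet R :=
    hRν w (k n) (α n) (ν n) (hα n) (hαA n) (hk n) (hν n)
  have hC := (hk 0).const_nonneg
  have hm₀ : 0 ≤ ∫ x, ‖x‖ ∂(μ₀ : Measure (State d)) := integral_nonneg fun x => norm_nonneg x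
  obtain ⟨κ, μ, hκ, hμ, hlim, hcont⟩ := exists_subseq_tendsto hT hR hmem fun φ hφ hφc => by
    obtain ⟨L, hL⟩ := ContDiff.lipschitzWith_of_hasCompactSupport hφc hφ (by simp)
    exact ⟨_, by positivity, fun n s hs t ht =>
      (hν n).abs_integral_sub_le (hk n) (hα n) hφ hφc hL hs ht⟩
  have hκt := hκ.tendsto_atTop
  -- Weights do not depend on `n`, and the growth bound survives pointwise limits.
  have hk'fam : IsVelocityFamily C w k' :=
    ⟨(hk 0).nonneg, (hk 0).sum_eq_one, fun i => (hk' i).measurable, fun i z =>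
      le_of_tendsto' ((tendstoLocallyUniformlyOn_univ.2 (hkk i)).tendsto_at (mem_univ z)).norm fun n => (hk n).growth i z⟩
  have hconst {l : Filter ℝ} (b : State d × State d → ℝ) :
      TendstoLocallyUniformly (fun _ => b) b l :=
    (TendstoUniformly.tendstoLocallyUniformly fun u hu =>
      Eventually.of_forall fun _ x => refl_mem_uniformity hu)
  have hmom {κ' : Type} {l : Filter κ'} {f : κ' → ProbabilityMeasure (State d)}
      {m : ProbabilityMeasure (State d)} (hf : ∀ᶠ i in l, f i ∈ tailSet R) (hm : m ∈ tailSet R)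
      (hfm : Tendsto f l (𝓝 m)) : Tendsto (fun i => ∫ x, ‖x‖ ∂(f i : Measure (State d))) l
        (𝓝 (∫ x, ‖x‖ ∂(m : Measure (State d)))) := by
    have hg (z : State d × State d) : ‖‖z.1‖‖ ≤ 1 * (1 + ‖z.1‖ + ‖z.2‖) := by
      rw [norm_norm]; linarith [norm_nonneg z.2]
    -- A first moment is the integral over pairs of the norm of the first state.
    have h := tendsto_integral_prod_of_tailSet hR hf hm hfm (b := fun _ z => ‖z.1‖)
      (b' := fun z => ‖z.1‖) (C := 1) (Eventually.of_forall fun _ => by fun_prop)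
      (Eventually.of_forall fun _ => hg) (by fun_prop) hg
      (TendstoUniformly.tendstoLocallyUniformly fun u hu =>
        Eventually.of_forall fun _ x => refl_mem_uniformity hu)
    simpa only [integral_comp_fst_self _ fun x => ‖x‖] using h
  have h0 : (0 : ℝ) ∈ Icc 0 T := ⟨le_rfl, hT⟩
  have hmomc : ContinuousOn (fun t => ∫ x, ‖x‖ ∂(μ t : Measure (State d))) (Icc 0 T) :=
    fun t ht => hmom (eventually_mem_nhdsWithin.mono hμ) (hμ t ht) (hcont t ht)
  refine ⟨κ, μ, hκ, fun t ht => ⟨hlim t ht,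
    hmom (Eventually.of_forall fun n => hmem _ t ht) (hμ t ht) (hlim t ht)⟩,
    ⟨fun t ht => hasFirstMoment_of_mem_tailSet (hμ t ht), ?_⟩, ?_, fun φ hφ hφc => ?_⟩
  · obtain ⟨B, hB⟩ := isCompact_Icc.exists_bound_of_continuousOn hmomc
    exact MemLp.of_bound (hmomc.aestronglyMeasurable measurableSet_Icc) B
      ((ae_restrict_mem measurableSet_Icc).mono hB)
  · refine tendsto_nhds_unique (hlim 0 h0) ?_
    simp only [fun n => (hν n).initial]
    exact tendsto_const_nhds
  obtain ⟨L, hL⟩ := ContDiff.lipschitzWith_of_hasCompactSupport hφc hφ (by simp)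
  have hfc := continuous_flux (w := w) hk' hφ
  refine ⟨fun t ht => tendsto_integral_prod_of_tailSet hR (eventually_mem_nhdsWithin.mono hμ)
    (hμ t ht) (hcont t ht) (Eventually.of_forall fun _ => hfc.measurable)
    (Eventually.of_forall fun _ => hk'fam.abs_flux_le hL) hfc (hk'fam.abs_flux_le hL)
    (hconst _), fun t ht => ?_⟩
  refine tendsto_nhds_unique
    (((continuous_integral_test hφ.continuous hφc).tendsto (μ t)).comp (hlim t ht)) ?_
  simp only [Function.comp_def, fun n => (hν (κ n)).integral_collision_eq (hk _) (hα _) hφ hφc ht]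
  refine tendsto_const_nhds.add ?_
  have hcol := tendstoLocallyUniformly_collision (fun n => hα (κ n)) (hα0.comp hκt)
    (fun n => hk (κ n)) (fun i u hu x => (hkk i u hu x).imp fun s hs => ⟨hs.1, hκt.eventually hs.2⟩) hφ hφc
  have hsub : uIoc (0 : ℝ) t ⊆ Icc 0 T := by
    rw [uIoc_of_le ht.1]
    exact Ioc_subset_Icc_self.trans (Icc_subset_Icc le_rfl ht.2)
  -- The dominating constant is the uniform bound on the collision operator. At each fixed time both
  -- the measures and the integrands converge.
  refine intervalIntegral.tendsto_integral_filter_of_dominated_convergence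
    (fun _ => L * C * (1 + 2 * ((1 + 2 * ∫ x, ‖x‖ ∂(μ₀ : Measure (State d))) *
      Real.exp (2 * C * T))))
    (Eventually.of_forall fun n => ((hν (κ n)).intervalIntegrable_collision (hk _) (hα _) hφ hφc
      ht).def'.aestronglyMeasurable)
    (Eventually.of_forall fun n => Eventually.of_forall fun s hs =>
      (hν (κ n)).abs_integral_collision_le (hk _) (hα _) hL (hsub hs))
    (by simp) (Eventually.of_forall fun s hs => ?_)
  exact tendsto_integral_prod_of_tailSet hR (Eventually.of_forall fun n => hmem _ s (hsub hs))
    (hμ s (hsub hs)) (hlim s (hsub hs))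
    (Eventually.of_forall fun n => (hk _).measurable_collision _ hφ.continuous)
    (Eventually.of_forall fun n => (hk _).abs_collision_le (hα _) hL) hfc
    (hk'fam.abs_flux_le hL) hcol

end Limit

end KineticControl

/-! ### The Boltzmann model as a collision dynamics -/

namespace KineticControl

variable {d : ℕ} {Ω : Type*} [MeasurableSpace Ω] {P : Measure Ω} {ΘX ΘY : Ω → ℝ} {p : ℝ}
  {H : State d → State d} {G : Fin d → State d → State d}

/-- The two values of a Bernoulli label. -/
def labelValue (b : Bool) : ℝ := if b then 1 else 0

theorem labelValue_mem (b : Bool) : labelValue b = 0 ∨ labelValue b = 1 := by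
  cases b <;> simp [labelValue]

/-- The masses `p` and `1 - p` of the disjoint events `Θ = 1` and `Θ = 0` add up to one. -/
theorem IsBernoulli.ae_eq_labelValue [IsProbabilityMeasure P] (hp : p ∈ Icc (0 : ℝ) 1) {Θ : Ω → ℝ}
    (h : IsBernoulli P Θ p) : ∀ᵐ ω ∂P, ∃ b, Θ ω = labelValue b := by
  obtain ⟨hm, h1, h0⟩ := h
  have m1 : MeasurableSet {ω | Θ ω = 1} := hm (measurableSet_singleton 1)
  have m0 : MeasurableSet {ω | Θ ω = 0} := hm (measurableSet_singleton 0)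
  have hu : P ({ω | Θ ω = 1} ∪ {ω | Θ ω = 0}) = 1 := by
    rw [measure_union _ m0, h1, h0, ← ENNReal.ofReal_add hp.1 (by linarith [hp.2])]
    · simp
    · rw [Set.disjoint_left]
      intro ω hω hω'
      simp only [Set.mem_ofPred_eq] at hω hω'
      linarith
  filter_upwards [(mem_ae_iff_prob_eq_one (m1.union m0)).2 hu] with ω hω
  rcases hω with hω | hω
  · exact ⟨true, by simpa [labelValue] using hω⟩
  · exact ⟨false, by simpa [labelValue] using hω⟩

/-- The joint law of the two labels. -/
noncomputable def labelWeight (P : Measure Ω) (ΘX ΘY : Ω → ℝ) (i : Bool × Bool) : ℝ :=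
  P.real {ω | ΘX ω = labelValue i.1 ∧ ΘY ω = labelValue i.2}

/-- The expectation over the labels is a finite sum. -/
theorem integral_labels [IsProbabilityMeasure P] (hp : p ∈ Icc (0 : ℝ) 1)
    (hX : IsBernoulli P ΘX p) (hY : IsBernoulli P ΘY p) {E : Type*} [NormedAddCommGroup E]
    [NormedSpace ℝ E] [CompleteSpace E] (F : ℝ → ℝ → E) :
    ∫ ω, F (ΘX ω) (ΘY ω) ∂P =
      ∑ i, labelWeight P ΘX ΘY i • F (labelValue i.1) (labelValue i.2) := by
  let S : Bool × Bool → Set Ω := fun i => {ω | ΘX ω = labelValue i.1 ∧ ΘY ω = labelValue i.2}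
  have hS (i) : MeasurableSet (S i) :=
    (hX.1 (measurableSet_singleton _)).inter (hY.1 (measurableSet_singleton _))
  have hinj {a b : Bool} (h : labelValue a = labelValue b) : a = b := by
    cases a <;> cases b <;> simp [labelValue] at h ⊢
  -- `F` needs no measurability, since the integrand is almost surely a simple function.
  calc ∫ ω, F (ΘX ω) (ΘY ω) ∂P
      = ∫ ω, ∑ i, (S i).indicator (fun _ => F (labelValue i.1) (labelValue i.2)) ω ∂P := by
        refine integral_congr_ae ?_
        filter_upwards [hX.ae_eq_labelValue hp, hY.ae_eq_labelValue hp] with ω ⟨a, ha⟩ ⟨b, hb⟩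
        rw [Finset.sum_eq_single (a, b)]
        · rw [indicator_of_mem (show ω ∈ S (a, b) from ⟨ha, hb⟩), ha, hb]
        · intro i _ hi
          refine indicator_of_notMem (fun hω : ω ∈ S i => hi ?_) _
          exact Prod.ext (hinj (hω.1.symm.trans ha)) (hinj (hω.2.symm.trans hb))
        · simp
    _ = _ := by
        rw [integral_finsetSum _ fun i _ => (integrable_const _).indicator (hS i)]
        exact Finset.sum_congr rfl fun i _ => integral_indicator_const _ (hS i)

/-- The velocity of the first of two agents with given labels, for the feedbacks `u` and `v`. -/
noncomputable def velocity (H : State d → State d) (G : Fin d → State d → State d)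
    (u v : State d × State d → State d) (i : Bool × Bool) (z : State d × State d) : State d :=
  interaction H G (labelValue i.1) (labelValue i.2) (z.1 - z.2) (u z) (v z)

theorem meanKernel_eq [IsProbabilityMeasure P] (hp : p ∈ Icc (0 : ℝ) 1)
    (hX : IsBernoulli P ΘX p) (hY : IsBernoulli P ΘY p) (K₁ K₂ : State d → State d → State d)
    (X Y : State d) :
    meanKernel P ΘX ΘY H G X Y (K₁ X Y) (K₂ X Y) = ∑ i, labelWeight P ΘX ΘY i •
      velocity H G (fun z => K₁ z.1 z.2) (fun z => K₂ z.1 z.2) i (X, Y) :=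
  integral_labels hp hX hY fun θ θ' => interaction H G θ θ' (X - Y) (K₁ X Y) (K₂ X Y)

theorem sum_labelWeight [IsProbabilityMeasure P] (hp : p ∈ Icc (0 : ℝ) 1)
    (hX : IsBernoulli P ΘX p) (hY : IsBernoulli P ΘY p) : ∑ i, labelWeight P ΘX ΘY i = 1 := by
  have h := integral_labels hp hX hY fun _ _ => (1 : ℝ)
  simpa using h.symm

theorem LinearGrowth.exists_nonneg {F : State d → State d} (h : LinearGrowth F) :
    ∃ C : ℝ, 0 ≤ C ∧ ∀ z, ‖F z‖ ≤ C * (1 + ‖z‖) := by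
  obtain ⟨C, hC⟩ := h
  exact ⟨C, by simpa using (norm_nonneg _).trans (hC 0), hC⟩

theorem norm_sum_smul_le (u : State d) (g : Fin d → State d) :
    ‖∑ l, u l • g l‖ ≤ ‖u‖ * ∑ l, ‖g l‖ := by
  rw [Finset.mul_sum]
  refine (norm_sum_le _ _).trans (Finset.sum_le_sum fun l _ => ?_)
  rw [norm_smul]
  exact mul_le_mul_of_nonneg_right (PiLp.norm_apply_le u l) (norm_nonneg _)

/-- Compactness of `𝒰` bounds every control by one `B`, so a single constant serves the feedbacks at
all strengths and the limit controls. -/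
theorem exists_isVelocityFamily [IsProbabilityMeasure P] (hp : p ∈ Icc (0 : ℝ) 1)
    (hX : IsBernoulli P ΘX p) (hY : IsBernoulli P ΘY p) (hH : Continuous H) (hHg : LinearGrowth H)
    (hG : ∀ l, Continuous (G l)) (hGg : ∀ l, LinearGrowth (G l)) {𝒰 : Set (State d)}
    (h𝒰 : IsCompact 𝒰) :
    ∃ C : ℝ, ∀ u v : State d × State d → State d, Measurable u → Measurable v →
      (∀ z, u z ∈ 𝒰) → (∀ z, v z ∈ 𝒰) →
      IsVelocityFamily C (labelWeight P ΘX ΘY) (velocity H G u v) := by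
  obtain ⟨B, hB⟩ := h𝒰.isBounded.exists_norm_le
  obtain ⟨CH, hCH0, hCH⟩ := hHg.exists_nonneg
  choose CG hCG0 hCG using fun l => (hGg l).exists_nonneg
  refine ⟨CH + B * ∑ l, CG l + B, fun u v hu hv huU hvU =>
    ⟨fun i => measureReal_nonneg, sum_labelWeight hp hX hY, fun i => ?_, fun i z => ?_⟩⟩
  · have hd : Measurable fun z : State d × State d => z.1 - z.2 := by fun_prop
    have h1 : Measurable fun z : State d × State d => H (z.1 - z.2) := hH.measurable.comp hd
    have h2 (l : Fin d) : Measurable fun z : State d × State d => G l (z.1 - z.2) :=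
      (hG l).measurable.comp hd
    have h3 (l : Fin d) : Measurable fun z : State d × State d => v z l :=
      (EuclideanSpace.proj (𝕜 := ℝ) l).continuous.measurable.comp hv
    have h4 : Measurable fun z : State d × State d => ∑ l, v z l • G l (z.1 - z.2) :=
      Finset.measurable_sum _ fun l _ => (h3 l).smul (h2 l)
    have h5 := h1.const_smul ((1 - labelValue i.1) * (1 - labelValue i.2))
    have h6 := h4.const_smul ((1 - labelValue i.1) * labelValue i.2)
    exact (h5.add h6).add (hu.const_smul (labelValue i.1))
  · have hB0 : 0 ≤ B := (norm_nonneg _).trans (hB _ (huU z))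
    have hS0 : 0 ≤ ∑ l, CG l := Finset.sum_nonneg fun l _ => hCG0 l
    have hz : ‖z.1 - z.2‖ ≤ ‖z.1‖ + ‖z.2‖ := norm_sub_le _ _
    have h1 : ‖H (z.1 - z.2)‖ ≤ CH * (1 + ‖z.1‖ + ‖z.2‖) :=
      (hCH _).trans (mul_le_mul_of_nonneg_left (by linarith) hCH0)
    have h2 : ‖∑ l, v z l • G l (z.1 - z.2)‖ ≤ B * (∑ l, CG l) * (1 + ‖z.1‖ + ‖z.2‖) := by
      refine (norm_sum_smul_le _ _).trans ?_
      rw [mul_assoc]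
      refine mul_le_mul (hB _ (hvU z)) ?_ (Finset.sum_nonneg fun l _ => norm_nonneg _) hB0
      rw [Finset.sum_mul]
      exact Finset.sum_le_sum fun l _ =>
        (hCG l _).trans (mul_le_mul_of_nonneg_left (by linarith) (hCG0 l))
    have h3 : ‖u z‖ ≤ B * (1 + ‖z.1‖ + ‖z.2‖) :=
      (hB _ (huU z)).trans (le_mul_of_one_le_right hB0
        (by linarith [norm_nonneg z.1, norm_nonneg z.2]))
    have n1 := norm_nonneg (H (z.1 - z.2))
    have n2 := norm_nonneg (∑ l, v z l • G l (z.1 - z.2))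
    have n3 := norm_nonneg (u z)
    rw [add_mul, add_mul]
    unfold velocity interaction
    rcases labelValue_mem i.1 with h | h <;> rcases labelValue_mem i.2 with h' | h' <;>
      rw [h, h'] <;> simp <;> linarith

theorem continuous_velocity (hH : Continuous H) (hG : ∀ l, Continuous (G l))
    {u v : State d × State d → State d} (hu : Continuous u) (hv : Continuous v)
    (i : Bool × Bool) : Continuous (velocity H G u v i) := by
  have h3 (l : Fin d) : Continuous fun z : State d × State d => v z l :=
    (EuclideanSpace.proj (𝕜 := ℝ) l).continuous.comp hv
  unfold velocity interaction
  fun_prop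

/-- The velocity is affine in the controls: `H` cancels in the difference, and the `G l` are bounded
on compact sets of pairs. -/
theorem tendstoLocallyUniformly_velocity {κ : Type*} {l : Filter κ} (hG : ∀ l, Continuous (G l))
    {u v : κ → State d × State d → State d} {u' v' : State d × State d → State d}
    (hu : TendstoLocallyUniformly u u' l) (hv : TendstoLocallyUniformly v v' l)
    (i : Bool × Bool) :
    TendstoLocallyUniformly (fun n => velocity H G (u n) (v n) i) (velocity H G u' v' i) l := by
  rw [tendstoLocallyUniformly_iff_forall_isCompact] at hu hv ⊢
  intro Z hZ
  have hgc : Continuous fun z : State d × State d => ∑ l, ‖G l (z.1 - z.2)‖ := by fun_prop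
  obtain ⟨B, hB⟩ := hZ.exists_bound_of_continuousOn hgc.continuousOn
  rw [Metric.tendstoUniformlyOn_iff]
  intro η hη
  have h1 := Metric.tendstoUniformlyOn_iff.1 (hu Z hZ) (η / 2) (by positivity)
  have h2 := Metric.tendstoUniformlyOn_iff.1 (hv Z hZ) (η / (2 * (|B| + 1))) (by positivity)
  filter_upwards [h1, h2] with n hn1 hn2 z hz
  have a1 := hn1 z hz
  have a2 := hn2 z hz
  rw [dist_eq_norm] at a1 a2 ⊢
  have key : velocity H G u' v' i z - velocity H G (u n) (v n) i z =
      ((1 - labelValue i.1) * labelValue i.2) • (∑ l, (v' z - v n z) l • G l (z.1 - z.2)) +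
        labelValue i.1 • (u' z - u n z) := by
    unfold velocity interaction
    simp only [PiLp.sub_apply, sub_smul, Finset.sum_sub_distrib, smul_sub]
    abel
  have h3 : ‖∑ l, (v' z - v n z) l • G l (z.1 - z.2)‖ < η / 2 := by
    have hb : ∑ l, ‖G l (z.1 - z.2)‖ ≤ |B| := (le_abs_self _).trans ((hB z hz).trans (le_abs_self B))
    calc ‖∑ l, (v' z - v n z) l • G l (z.1 - z.2)‖
        ≤ ‖v' z - v n z‖ * ∑ l, ‖G l (z.1 - z.2)‖ := norm_sum_smul_le _ _
      _ ≤ ‖v' z - v n z‖ * |B| := by gcongr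
      _ ≤ η / (2 * (|B| + 1)) * |B| := by gcongr
      _ < η / (2 * (|B| + 1)) * (|B| + 1) := by gcongr; linarith
      _ = η / 2 := by field_simp
  rw [key]
  generalize ∑ l, (v' z - v n z) l • G l (z.1 - z.2) = q at h3 ⊢
  refine lt_of_le_of_lt (norm_add_le _ _) ?_
  rw [norm_smul, norm_smul]
  rcases labelValue_mem i.1 with h | h <;> rcases labelValue_mem i.2 with h' | h' <;>
    rw [h, h'] <;> simp <;> linarith

/-- The Boltzmann operator at frequency `1 / α` is the integral of the collision rate. -/
theorem boltzmannOperator_eq [IsProbabilityMeasure P] (hp : p ∈ Icc (0 : ℝ) 1)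
    (hX : IsBernoulli P ΘX p) (hY : IsBernoulli P ΘY p) {C α : ℝ}
    {U₁ U₂ : State d → State d → State d}
    (hk : IsVelocityFamily C (labelWeight P ΘX ΘY)
      (velocity H G (fun z => U₁ z.1 z.2) fun z => U₂ z.2 z.1))
    (ν : ProbabilityMeasure (State d)) {φ : State d → ℝ} (hφ : Continuous φ)
    (hφc : HasCompactSupport φ) :
    boltzmannOperator P ΘX ΘY H G α (1 / α) U₁ U₂ (ν : Measure (State d)) φ =
      ∫ z, collision (labelWeight P ΘX ΘY)
        (velocity H G (fun z => U₁ z.1 z.2) fun z => U₂ z.2 z.1) α φ z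
        ∂((ν : Measure (State d)).prod (ν : Measure (State d))) := by
  set k := velocity H G (fun z => U₁ z.1 z.2) fun z => U₂ z.2 z.1 with hkdef
  obtain ⟨B, hB⟩ := hφc.exists_bound_of_continuous hφ
  have hint (i : Bool × Bool) : Integrable (fun z : State d × State d =>
      φ (z.1 + α • k i z) - φ z.1) ((ν : Measure (State d)).prod (ν : Measure (State d))) := by
    have h1 : Measurable fun z : State d × State d => z.1 + α • k i z :=
      measurable_fst.add ((hk.measurable i).const_smul α)
    have h2 : Measurable fun z : State d × State d => φ (z.1 + α • k i z) :=
      hφ.measurable.comp h1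
    have h3 : Measurable fun z : State d × State d => φ z.1 := hφ.measurable.comp measurable_fst
    exact (integrable_const (B + B)).mono' (h2.sub h3).aestronglyMeasurable
      (Eventually.of_forall fun z => (norm_sub_le _ _).trans (add_le_add (hB _) (hB _)))
  unfold boltzmannOperator collision
  rw [integral_labels hp hX hY fun θ θ' => ∫ X, ∫ Y,
    (φ (postInteraction H G α U₁ U₂ θ θ' X Y).1 - φ X) ∂(ν : Measure (State d))
      ∂(ν : Measure (State d)),
    integral_finsetSum _ fun i _ => ((hint i).const_mul _).const_mul _, Finset.mul_sum]
  refine Finset.sum_congr rfl fun i _ => ?_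
  rw [integral_const_mul, integral_const_mul, integral_prod _ (hint i), one_div, smul_eq_mul]
  exact mul_left_comm _ _ _

/-- The transport operator of the averaged kernel is the integral of the flux. -/
theorem transportOperator_eq [IsProbabilityMeasure P] (hp : p ∈ Icc (0 : ℝ) 1)
    (hX : IsBernoulli P ΘX p) (hY : IsBernoulli P ΘY p) {C : ℝ}
    {K₁ K₂ : State d → State d → State d}
    (hk : IsVelocityFamily C (labelWeight P ΘX ΘY)
      (velocity H G (fun z => K₁ z.1 z.2) fun z => K₂ z.1 z.2))
    (hkc : ∀ i, Continuous (velocity H G (fun z => K₁ z.1 z.2) (fun z => K₂ z.1 z.2) i))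
    {ν : ProbabilityMeasure (State d)} (hν : HasFirstMoment ν) {φ : State d → ℝ}
    (hφ : ContDiff ℝ (⊤ : ℕ∞) φ) (hφc : HasCompactSupport φ) :
    transportOperator (fun X Y => meanKernel P ΘX ΘY H G X Y (K₁ X Y) (K₂ X Y))
        (ν : Measure (State d)) φ =
      ∫ z, flux (labelWeight P ΘX ΘY)
        (velocity H G (fun z => K₁ z.1 z.2) fun z => K₂ z.1 z.2) φ z
        ∂((ν : Measure (State d)).prod (ν : Measure (State d))) := by
  obtain ⟨L, hL⟩ := ContDiff.lipschitzWith_of_hasCompactSupport hφc hφ (by simp)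
  -- Fubini, after which the linear form `fderiv ℝ φ X` is taken through the integral over the
  -- partner.
  rw [integral_prod _ (hν.integrable_of_growth (continuous_flux hkc hφ).aestronglyMeasurable
    (hk.abs_flux_le hL))]
  unfold transportOperator
  refine integral_congr_ae (Eventually.of_forall fun X => ?_)
  have hint (i : Bool × Bool) : Integrable (fun Y =>
      velocity H G (fun z => K₁ z.1 z.2) (fun z => K₂ z.1 z.2) i (X, Y))
      (ν : Measure (State d)) := by
    refine (((integrable_const (1 + ‖X‖)).add hν).const_mul C).mono'
      ((hkc i).comp (by fun_prop : Continuous fun Y : State d => (X, Y))).aestronglyMeasurable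
      (Eventually.of_forall fun Y => hk.growth i (X, Y))
  simp only [meanKernel_eq hp hX hY, flux]
  have hsum : Integrable (fun Y => ∑ i, labelWeight P ΘX ΘY i •
      velocity H G (fun z => K₁ z.1 z.2) (fun z => K₂ z.1 z.2) i (X, Y))
      (ν : Measure (State d)) := integrable_finsetSum _ fun i _ =>
    (hint i).smul (labelWeight P ΘX ΘY i)
  rw [← ContinuousLinearMap.integral_comp_comm _ hsum]
  refine integral_congr_ae (Eventually.of_forall fun Y => ?_)
  simp only [map_sum, map_smul, smul_eq_mul]

/-- The fundamental theorem of calculus for the extension of `b` by its end values, which is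
continuous on the line; restricting to `[0, T]` gives one-sided derivatives at the end points. -/
theorem hasDerivWithinAt_of_eq_integral {T c : ℝ} (hT : 0 ≤ T) {F b : ℝ → ℝ}
    (hb : ContinuousOn b (Icc 0 T))
    (hF : ∀ t ∈ Icc 0 T, F t = c + ∫ s in (0 : ℝ)..t, b s) {t : ℝ} (ht : t ∈ Icc 0 T) :
    HasDerivWithinAt F (b t) (Icc 0 T) t := by
  let g : ℝ → ℝ := fun s => b (projIcc 0 T hT s)
  have hg : Continuous g := hb.comp_continuous (continuous_subtype_val.comp continuous_projIcc)
    fun s => (projIcc 0 T hT s).2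
  have hgb (s : ℝ) (hs : s ∈ Icc 0 T) : g s = b s := by simp only [g, projIcc_of_mem hT hs]
  have hd := ((hg.integral_hasStrictDerivAt 0 t).hasDerivAt.const_add c).hasDerivWithinAt
    (s := Icc 0 T)
  rw [hgb t ht] at hd
  have heq (r : ℝ) (hr : r ∈ Icc 0 T) : F r = c + ∫ s in (0 : ℝ)..r, g s := by
    rw [hF r hr]
    congr 1
    refine intervalIntegral.integral_congr fun s hs => ?_
    rw [uIcc_of_le hr.1] at hs
    exact (hgb s ⟨hs.1, hs.2.trans hr.2⟩).symm
  exact hd.congr heq (heq t ht)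

end KineticControl

/-! ### The limit theorem and suboptimality -/

theorem mainTheorem9 {d : ℕ} {Ω : Type*} [MeasurableSpace Ω] (P : Measure Ω)
    [IsProbabilityMeasure P] (p : ℝ) (hp : p ∈ Icc (0 : ℝ) 1) (ΘX ΘY : Ω → ℝ)
    (hΘX : IsBernoulli P ΘX p) (hΘY : IsBernoulli P ΘY p) (hΘ : IndepFun ΘX ΘY P)
    (H : State d → State d) (G : Fin d → State d → State d)
    (hH : Continuous H) (hHg : LinearGrowth H)
    (hG : ∀ l, Continuous (G l)) (hGg : ∀ l, LinearGrowth (G l))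
    (𝒰 : Set (State d)) (h𝒰 : IsCompact 𝒰)
    (U₁ U₂ : ℝ → State d → State d → State d) (K₁ K₂ : State d → State d → State d)
    (hU₁m : ∀ α > 0, Measurable fun z : State d × State d => U₁ α z.1 z.2)
    (hU₂m : ∀ α > 0, Measurable fun z : State d × State d => U₂ α z.1 z.2)
    (hU₁ : ∀ α > 0, ∀ X Y, U₁ α X Y ∈ 𝒰) (hU₂ : ∀ α > 0, ∀ X Y, U₂ α X Y ∈ 𝒰)
    (hK₁ : Continuous fun z : State d × State d => K₁ z.1 z.2)
    (hK₂ : Continuous fun z : State d × State d => K₂ z.1 z.2)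
    (hlim₁ : TendstoLocallyUniformly (fun (α : ℝ) (z : State d × State d) => U₁ α z.1 z.2)
      (fun z => K₁ z.1 z.2) (𝓝[>] 0))
    (hlim₂ : TendstoLocallyUniformly (fun (α : ℝ) (z : State d × State d) => U₂ α z.2 z.1)
      (fun z => K₂ z.1 z.2) (𝓝[>] 0))
    (T : ℝ) (hT : 0 < T) (μ₀ : ProbabilityMeasure (State d)) (hμ₀ : HasFirstMoment μ₀)
    (με : ℝ → ℝ → ProbabilityMeasure (State d))
    (hμε : ∀ ε > 0,
      IsBoltzmannSolution P ΘX ΘY H G ε (1 / ε) (U₁ ε) (U₂ ε) T μ₀ (με ε))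
    (γ : ℝ) (hγ : 0 < γ) (Xbar : State d)
    (ε : ℕ → ℝ) (hε : ∀ n, 0 < ε n) (hε0 : Tendsto ε atTop (𝓝 0)) :
    ∃ (k : ℕ → ℕ) (μ : ℝ → ProbabilityMeasure (State d)), StrictMono k ∧
      (∀ t ∈ Icc 0 T,
        Tendsto (fun n => με (ε (k n)) t) atTop (𝓝 (μ t)) ∧
        Tendsto (fun n => ∫ x, ‖x‖ ∂(με (ε (k n)) t : Measure (State d))) atTop
          (𝓝 (∫ x, ‖x‖ ∂(μ t : Measure (State d))))) ∧
      IsContinuitySolution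
        (fun X Y => meanKernel P ΘX ΘY H G X Y (K₁ X Y) (K₂ X Y)) T μ₀ μ ∧
      IsAdmissible P ΘX ΘY H G 𝒰 T μ₀ μ (MeanFieldControl.stationary K₁ K₂) ∧
      binaryValue P ΘX ΘY H G 𝒰 T γ Xbar μ₀ ≤
        cost T γ Xbar μ (MeanFieldControl.stationary K₁ K₂) ∧
      ∀ κ : State d → State d, (∀ X Y, K₁ X Y = κ X) → (∀ X Y, K₂ X Y = κ Y) →
        feedbackValue P ΘX ΘY H G 𝒰 T γ Xbar μ₀ ≤
          cost T γ Xbar μ (MeanFieldControl.ofFeedback fun _ => κ) := by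

  obtain ⟨C, hC⟩ := exists_isVelocityFamily hp hΘX hΘY hH hHg hG hGg h𝒰
  have hε0' : Tendsto ε atTop (𝓝[>] 0) :=
    tendsto_nhdsWithin_iff.2 ⟨hε0, Eventually.of_forall hε⟩
  have hfam (α : ℝ) (hα : 0 < α) : IsVelocityFamily C (labelWeight P ΘX ΘY)
      (velocity H G (fun z => U₁ α z.1 z.2) fun z => U₂ α z.2 z.1) :=
    hC _ _ (hU₁m α hα) ((hU₂m α hα).comp measurable_swap) (fun z => hU₁ α hα _ _)
      fun z => hU₂ α hα _ _
  -- Limits of values in the closed set `𝒰` stay in it; this makes the limit controls admissible.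
  have hK₁mem (X Y : State d) : K₁ X Y ∈ 𝒰 :=
    h𝒰.isClosed.mem_of_tendsto
      ((tendstoLocallyUniformlyOn_univ.2 hlim₁).tendsto_at (mem_univ (X, Y)))
      (eventually_mem_nhdsWithin.mono fun α hα => hU₁ α hα X Y)
  have hK₂mem (X Y : State d) : K₂ X Y ∈ 𝒰 :=
    h𝒰.isClosed.mem_of_tendsto
      ((tendstoLocallyUniformlyOn_univ.2 hlim₂).tendsto_at (mem_univ (X, Y)))
      (eventually_mem_nhdsWithin.mono fun α hα => hU₂ α hα Y X)
  have hKfam : IsVelocityFamily C (labelWeight P ΘX ΘY)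
      (velocity H G (fun z => K₁ z.1 z.2) fun z => K₂ z.1 z.2) :=
    hC _ _ hK₁.measurable hK₂.measurable (fun z => hK₁mem _ _) fun z => hK₂mem _ _
  have hKc := continuous_velocity hH hG hK₁ hK₂
  have hk (i : Bool × Bool) : TendstoLocallyUniformly
      (fun n => velocity H G (fun z => U₁ (ε n) z.1 z.2) (fun z => U₂ (ε n) z.2 z.1) i)
      (velocity H G (fun z => K₁ z.1 z.2) (fun z => K₂ z.1 z.2) i) atTop :=
    fun s hs x => (tendstoLocallyUniformly_velocity hG hlim₁ hlim₂ i s hs x).imp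
      fun t ht => ⟨ht.1, hε0'.eventually ht.2⟩
  have hsol (n : ℕ) : IsCollisionSolution (labelWeight P ΘX ΘY)
      (velocity H G (fun z => U₁ (ε n) z.1 z.2) fun z => U₂ (ε n) z.2 z.1) (ε n) T μ₀
      (με (ε n)) := by
    refine ⟨(hμε _ (hε n)).memL2P1, (hμε _ (hε n)).initial, fun φ hφ hφc t ht => ?_⟩
    rw [← boltzmannOperator_eq hp hΘX hΘY (hfam _ (hε n)) _ hφ.continuous hφc]
    exact (hμε _ (hε n)).weak φ hφ hφc t ht
  obtain ⟨k, μ, hkm, hconv, hmem, hinit, hweak⟩ := exists_quasiInvariant_limit hT.le hμ₀ hε hε0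
    (fun n => hfam _ (hε n)) hKc hk hsol
  have htrans (φ : State d → ℝ) (hφ : ContDiff ℝ (⊤ : ℕ∞) φ) (hφc : HasCompactSupport φ) (t : ℝ)
      (ht : t ∈ Icc 0 T) :=
    transportOperator_eq hp hΘX hΘY hKfam hKc (hmem.1 t ht) hφ hφc
  have hadm : IsAdmissible P ΘX ΘY H G 𝒰 T μ₀ μ (MeanFieldControl.stationary K₁ K₂) := by
    refine ⟨hK₁.measurable.comp measurable_snd, hK₂.measurable.comp measurable_snd,
      fun t _ X Y => hK₁mem X Y, fun t _ X Y => hK₂mem X Y, hmem, hinit, fun φ hφ hφc => ?_,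
      fun φ hφ hφc t ht => ?_⟩
    · refine ContinuousOn.intervalIntegrable ?_
      rw [uIcc_of_le hT.le]
      exact (hweak φ hφ hφc).1.congr (htrans φ hφ hφc)
    · rw [(hweak φ hφ hφc).2 t ht]
      congr 1
      refine intervalIntegral.integral_congr fun s hs => ?_
      rw [uIcc_of_le ht.1] at hs
      exact (htrans φ hφ hφc s ⟨hs.1, hs.2.trans ht.2⟩).symm
  refine ⟨k, μ, hkm, hconv, ⟨hmem, hinit, fun φ hφ hφc t ht => ?_⟩, hadm,
    iInf_le_of_le μ (iInf_le_of_le _ (iInf_le_of_le hadm le_rfl)), fun κ h₁ h₂ => ?_⟩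
  · rw [htrans φ hφ hφc t ht]
    exact hasDerivWithinAt_of_eq_integral hT.le (hweak φ hφ hφc).1 (hweak φ hφ hφc).2 ht
  -- Here the stationary pair control is itself of feedback form, so the same curve competes in the
  -- smaller class.
  · have hcontrol : MeanFieldControl.stationary K₁ K₂ = MeanFieldControl.ofFeedback fun _ => κ := by
      unfold MeanFieldControl.stationary MeanFieldControl.ofFeedback
      simp only [h₁, h₂]
    rw [hcontrol] at hadm
    exact iInf_le_of_le μ (iInf_le_of_le _ (iInf_le_of_le hadm le_rfl))
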